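/- Let $G$ and $H$ be second countable locally compact Hausdorff groupoids with open range and source maps and with Haar systems $\{\lambda_G^u\}_{u\in G^{(0)}}$ and $\{\lambda_H^v\}_{v\in H^{(0)}}$. Let $G$ act continuously on $H$ by isomorphisms with moment map $\rho:H\to G^{(0)}$: $\rho$ is a continuous open surjection whose fibres are subgroupoids of $H$, $x\cdot h$ is defined when $s(x)=\rho(h)$, and $h\mapsto x\cdot h$ is a groupoid isomorphism of $\rho^{-1}(s(x))$ onto $\rho^{-1}(r(x))$. Assume that the Haar system of $H$ is invariant: $\int f(x\cdot h)\,d\lambda_H^v(h)=\int f(h)\,d\lambda_H^{x\cdot v}(h)$ for all $f\in C_c(H)$, $x\in G$ and $v\in H^{(0)}$ with $s(x)=\rho(v)$. Let $H\rtimes G=\{(h,x)\in H\times G:\rho(h)=r(x)\}$ be the semidirect product groupoid, with $(h,x)(k,y)=(h(x\cdot k),xy)$ when $s(h)=x\cdot r(k)$ and $(h,x)^{-1}=(x^{-1}\cdot h^{-1},x^{-1})$; its unit space is identified with $H^{(0)}$ through $v\mapsto(v,\rho(v))$, and it carries the Haar system $d\lambda^{v}(h,x)=d\lambda_H^v(h)\,d\lambda_G^{\rho(v)}(x)$.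 Let $G_\rho=\{(v,x)\in H\rtimes G: v\in H^{(0)}\}$ be the subgroupoid with the same unit space and with the Haar system $\int f\,d\sigma^v=\int_G f(v,x)\,d\lambda_G^{\rho(v)}(x)$. For a groupoid $K$ with Haar system $\{\kappa^u\}$ and a measure $\mu$ on $K^{(0)}$, let $\nu=\int\kappa^u\,d\mu(u)$ and let $\nu^{-1}$ be its image under inversion. The measure $\mu$ is quasi-invariant if $\nu$ and $\nu^{-1}$ are equivalent, and a modular function for $\mu$ is a Borel homomorphism $\Delta:K\to(0,\infty)$ with $d\nu=\Delta\,d\nu^{-1}$. Let $\mu$ be a $\sigma$-finite Borel measure on $H^{(0)}$ that is quasi-invariant for $H\rtimes G$, and let $\Delta$ be a modular function for it on $H\rtimes G$. Then $\mu$ is quasi-invariant for $H$ and for $G_\rho$, the function $\Delta_H(h)=\Delta(h,\rho(h))$ is a modular function for $\mu$ on $H$, the function $\delta(v,x)=\Delta(v,x)$ is a modular function for $\mu$ on $G_\rho$, and for every $(h,x)\in H\rtimes G$ $$\Delta(h,x)=\Delta_H(h)\,\delta(s_H(h),x).$$ -/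

import Mathlib

set_option linter.unusedSectionVars false

open MeasureTheory Set Filter Topology
open scoped ENNReal CompactlySupported

/-! ### Groupoids, described by their arrows -/

/-- A groupoid, given by its set `G` of arrows. Units are arrows, `rng x = x x⁻¹` and
`src x = x⁻¹ x`, and the product `mul x y h` is defined exactly when `src x = rng y`. -/
class ArrowGroupoid (G : Type*) where
  rng : G → G
  src : G → G
  mul : (x y : G) → src x = rng y → G
  inv : G → G
  rng_rng : ∀ x, rng (rng x) = rng x
  src_rng : ∀ x, src (rng x) = rng x
  rng_src : ∀ x, rng (src x) = src x
  rng_mul : ∀ x y h, rng (mul x y h) = rng x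
  src_mul : ∀ x y h, src (mul x y h) = src y
  rng_inv : ∀ x, rng (inv x) = src x
  src_inv : ∀ x, src (inv x) = rng x
  assoc_mul : ∀ x y z (hxy : src x = rng y) (hyz : src y = rng z),
    mul (mul x y hxy) z ((src_mul x y hxy).trans hyz) =
      mul x (mul y z hyz) (hxy.trans (rng_mul y z hyz).symm)
  rng_mul_self : ∀ x, mul (rng x) x (src_rng x) = x
  mul_src_self : ∀ x, mul x (src x) (rng_src x).symm = x
  mul_inv_eq : ∀ x, mul x (inv x) (rng_inv x).symm = rng x
  inv_mul_eq : ∀ x, mul (inv x) x (src_inv x) = src x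

namespace ArrowGroupoid

/-- The unit space `G⁽⁰⁾`. -/
abbrev UnitSpace (G : Type*) [ArrowGroupoid G] : Type _ := {u : G // rng u = u}

section Algebra

variable {G : Type*} [ArrowGroupoid G]

/-- The range map `G → G⁽⁰⁾`. -/
def rngUnit (x : G) : UnitSpace G := ⟨rng x, rng_rng x⟩

/-- The source map `G → G⁽⁰⁾`. -/
def srcUnit (x : G) : UnitSpace G := ⟨src x, rng_src x⟩

theorem src_of_unit {u : G} (hu : rng u = u) : src u = u := by
  have h := src_rng u
  rwa [hu] at h

theorem mul_congr_arrow {x x' y y' : G} (hx : x = x') (hy : y = y') (h : src x = rng y)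
    (h' : src x' = rng y') : mul x y h = mul x' y' h' := by
  subst hx; subst hy; rfl

theorem cancel_left {x y z : G} (hy : src x = rng y) (hz : src x = rng z)
    (e : mul x y hy = mul x z hz) : y = z := by
  have key : ∀ w (hw : src x = rng w),
      mul (inv x) (mul x w hw) ((src_inv x).trans (rng_mul x w hw).symm) = w := by
    intro w hw
    rw [← assoc_mul (inv x) x w (src_inv x) hw]
    exact (mul_congr_arrow ((inv_mul_eq x).trans hw) rfl _ (src_rng w)).trans (rng_mul_self w)
  rw [← key y hy, ← key z hz]
  exact mul_congr_arrow rfl e _ _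

theorem eq_inv_of_mul_eq {x y : G} (h : src x = rng y) (e : mul x y h = rng x) : y = inv x :=
  cancel_left h (rng_inv x).symm (e.trans (mul_inv_eq x).symm)

theorem eq_inv_of_mul_eq_src {x y : G} (h : src x = rng y) (e : mul x y h = src y) :
    x = inv y := by
  have hs : src x = rng (mul y (inv y) (rng_inv y).symm) := h.trans (rng_mul _ _ _).symm
  have h1 : x = mul x (mul y (inv y) (rng_inv y).symm) hs :=
    ((mul_congr_arrow rfl (h.trans (mul_inv_eq y).symm) (rng_src x).symm hs).symm.trans
      (mul_src_self x)).symm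
  rw [h1, ← assoc_mul x y (inv y) h]
  exact (mul_congr_arrow (e.trans (rng_inv y).symm) rfl _ (src_rng _)).trans (rng_mul_self _)

theorem inv_inv_eq (x : G) : inv (inv x) = x :=
  (eq_inv_of_mul_eq (src_inv x) ((inv_mul_eq x).trans (rng_inv x).symm)).symm

theorem inv_mul_mul (x y : G) (h : src x = rng y) (e : src (inv (mul x y h)) = rng x) :
    mul (inv (mul x y h)) x e = inv y := by
  refine eq_inv_of_mul_eq_src ((src_mul _ _ _).trans h) ?_
  rw [assoc_mul _ _ _ e h, inv_mul_eq, src_mul]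

theorem isUnit_of_mul_self {x : G} (h : src x = rng x) (e : mul x x h = x) : rng x = x := by
  have h1 : x = src x := cancel_left h (rng_src x).symm (e.trans (mul_src_self x).symm)
  exact h.symm.trans h1.symm

theorem mul_unit {x u : G} (h : src x = rng u) (hu : rng u = u) : mul x u h = x :=
  (mul_congr_arrow rfl (hu.symm.trans h.symm) _ (rng_src x).symm).trans (mul_src_self x)

theorem unit_mul {x u : G} (h : src u = rng x) (hu : rng u = u) : mul u x h = x :=
  (mul_congr_arrow ((src_of_unit hu).symm.trans h) rfl _ (src_rng x)).trans (rng_mul_self x)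

theorem inv_of_unit {u : G} (hu : rng u = u) : inv u = u :=
  (eq_inv_of_mul_eq ((src_of_unit hu).trans hu.symm)
    ((mul_unit ((src_of_unit hu).trans hu.symm) hu).trans hu.symm)).symm

end Algebra

end ArrowGroupoid

open ArrowGroupoid

/-- A topological groupoid with open range and source maps. -/
class OpenTopGroupoid (G : Type*) [TopologicalSpace G] [ArrowGroupoid G] : Prop where
  continuous_inv : Continuous (inv : G → G)
  continuous_mul : Continuous fun p : {p : G × G // src p.1 = rng p.2} => mul p.1.1 p.1.2 p.2
  continuous_rng : Continuous (rng : G → G)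
  continuous_src : Continuous (src : G → G)
  isOpenMap_rng : IsOpenMap (rngUnit : G → UnitSpace G)
  isOpenMap_src : IsOpenMap (srcUnit : G → UnitSpace G)

/-! ### Haar systems, quasi-invariant measures and modular functions -/

/-- A (left) Haar system on a second countable locally compact Hausdorff groupoid: Radon measures
`λᵘ` with support `r⁻¹(u)`, such that `u ↦ ∫ f dλᵘ` is continuous and
`∫ f(xy) dλ^{s(x)}(y) = ∫ f(y) dλ^{r(x)}(y)` for all `f ∈ C_c(G)`. -/
structure HaarSystem (G : Type*) [TopologicalSpace G] [MeasurableSpace G] [ArrowGroupoid G] where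
  meas : UnitSpace G → Measure G
  finite_on_compacts : ∀ u, IsFiniteMeasureOnCompacts (meas u)
  support_eq : ∀ u, (meas u).support = {x : G | rng x = u.1}
  continuous_integral : ∀ f : C_c(G, ℝ), Continuous fun u => ∫ x, f x ∂(meas u)
  left_invariant : ∀ (f : C_c(G, ℝ)) (x : G),
    ∫ y : {y : G // src x = rng y}, f (mul x y.1 y.2) ∂((meas (srcUnit x)).comap Subtype.val) =
      ∫ y, f y ∂(meas (rngUnit x))

instance {G : Type*} [TopologicalSpace G] [MeasurableSpace G] [ArrowGroupoid G]
    (lam : HaarSystem G) (u : UnitSpace G) : IsFiniteMeasureOnCompacts (lam.meas u) :=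
  lam.finite_on_compacts u

/-- A measure-valued map is measurable if it is so on a countable increasing cover. -/
theorem measurable_of_measurable_restrict {A X : Type*} [MeasurableSpace A] [MeasurableSpace X]
    {κ : A → Measure X} (S : ℕ → Set X) (hmono : Monotone S) (hcov : ⋃ n, S n = univ)
    (h : ∀ n, Measurable fun a => (κ a).restrict (S n)) : Measurable κ := by
  refine Measure.measurable_of_measurable_coe _ fun s hs => ?_
  have : (fun a => κ a s) = fun a => ⨆ n, (κ a).restrict (S n) s := by
    funext a
    simp_rw [Measure.restrict_apply hs]
    rw [← Monotone.measure_iUnion (fun i j hij => inter_subset_inter_right s (hmono hij)),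
      ← inter_iUnion, hcov, inter_univ]
  rw [this]
  exact Measurable.iSup fun n => (Measure.measurable_coe hs).comp (h n)

/-- The measures of a Haar system depend measurably on the unit. -/
theorem HaarSystem.measurable_meas {G : Type*} [TopologicalSpace G] [MeasurableSpace G]
    [BorelSpace G] [LocallyCompactSpace G] [T2Space G] [SecondCountableTopology G]
    [ArrowGroupoid G] (lam : HaarSystem G) : Measurable lam.meas := by
  have hK : ∀ K : Set G, IsCompact K → Measurable fun u => lam.meas u K := by
    intro K hK
    obtain ⟨f, hfK, -, hfc, hf01⟩ := exists_continuous_one_zero_of_isCompact_of_isGδ hK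
      hK.isClosed.isGδ isClosed_empty (disjoint_empty K)
    have hlim : ∀ u, Tendsto (fun n : ℕ => ∫ x, f x ^ (n + 1) ∂(lam.meas u)) atTop
        (𝓝 ((lam.meas u).real K)) := by
      intro u
      rw [← integral_indicator_one hK.measurableSet]
      refine tendsto_integral_of_dominated_convergence (fun x => f x)
        (fun n => (f.continuous.pow _).aestronglyMeasurable)
        (f.continuous.integrable_of_hasCompactSupport hfc) ?_ ?_
      · intro n
        refine Eventually.of_forall fun x => ?_
        rw [Real.norm_of_nonneg (pow_nonneg (hf01 x).1 _)]
        exact pow_le_of_le_one (hf01 x).1 (hf01 x).2 (Nat.succ_ne_zero n)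
      · refine Eventually.of_forall fun x => ?_
        by_cases hx : x ∈ K
        · have h1 : f x = 1 := by rw [hfK] at hx; exact hx
          simp [hx, h1]
        · have h1 : f x ≠ 1 := fun h1 => hx (by rw [hfK]; exact h1)
          simp only [hx, not_false_eq_true, indicator_of_notMem]
          exact (tendsto_add_atTop_iff_nat 1).2
            (tendsto_pow_atTop_nhds_zero_of_lt_one (hf01 x).1 (lt_of_le_of_ne (hf01 x).2 h1))
    have hreal : Measurable fun u => (lam.meas u).real K := by
      refine measurable_of_tendsto_metrizable (f := fun (n : ℕ) u =>
        ∫ x, f x ^ (n + 1) ∂(lam.meas u)) (fun n => ?_) (tendsto_pi_nhds.2 hlim)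
      have hc : HasCompactSupport fun x => f x ^ (n + 1) :=
        hfc.comp_left (g := fun t : ℝ => t ^ (n + 1)) (by simp)
      exact (lam.continuous_integral ⟨⟨fun x => f x ^ (n + 1), f.continuous.pow _⟩, hc⟩).measurable
    have : (fun u => lam.meas u K) = fun u => ENNReal.ofReal ((lam.meas u).real K) := by
      funext u
      rw [ofReal_measureReal hK.measure_lt_top.ne]
    rw [this]
    exact hreal.ennreal_ofReal
  refine measurable_of_measurable_restrict (compactCovering G)
    (fun _ _ h => compactCovering_subset G h) (iUnion_compactCovering G) fun n => ?_
  have hn := isCompact_compactCovering G n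
  have hfin : ∀ u, IsFiniteMeasure ((lam.meas u).restrict (compactCovering G n)) :=
    fun u => ⟨by simpa using hn.measure_lt_top⟩
  refine Measurable.measure_of_isPiSystem (S := {K : Set G | IsCompact K}) ?_ ?_ ?_ ?_
  · rw [BorelSpace.measurable_eq (α := G), borel_eq_generateFrom_isClosed]
    refine le_antisymm (MeasurableSpace.generateFrom_le fun C hC => ?_)
      (MeasurableSpace.generateFrom_le fun K hK =>
        MeasurableSpace.measurableSet_generateFrom hK.isClosed)
    have : C = ⋃ n, C ∩ compactCovering G n := by
      rw [← inter_iUnion, iUnion_compactCovering, inter_univ]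
    rw [this]
    exact @MeasurableSet.iUnion _ _ (MeasurableSpace.generateFrom _) _ _ fun n =>
      MeasurableSpace.measurableSet_generateFrom
        ((isCompact_compactCovering G n).inter_left hC)
  · exact fun K hK L hL _ => hK.inter hL
  · intro K hK'
    simp_rw [Measure.restrict_apply (IsCompact.measurableSet hK')]
    exact hK _ (IsCompact.inter hK' hn)
  · simp_rw [Measure.restrict_apply MeasurableSet.univ, univ_inter]
    exact hK _ hn

theorem measurable_prod_meas {A X Y : Type*} [MeasurableSpace A]
    [TopologicalSpace X] [T2Space X] [SigmaCompactSpace X] [MeasurableSpace X] [BorelSpace X]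
    [TopologicalSpace Y] [T2Space Y] [SigmaCompactSpace Y] [MeasurableSpace Y] [BorelSpace Y]
    {κ : A → Measure X} {η : A → Measure Y} (hκ : Measurable κ) (hη : Measurable η)
    [∀ a, IsFiniteMeasureOnCompacts (κ a)] [∀ a, IsFiniteMeasureOnCompacts (η a)] :
    Measurable fun a => (κ a).prod (η a) := by
  refine measurable_of_measurable_restrict
    (fun n => compactCovering X n ×ˢ compactCovering Y n)
    (fun _ _ h => prod_mono (compactCovering_subset X h) (compactCovering_subset Y h)) ?_
    fun n => ?_
  · rw [iUnion_prod_of_monotone (fun _ _ h => compactCovering_subset X h)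
      (fun _ _ h => compactCovering_subset Y h), iUnion_compactCovering, iUnion_compactCovering,
      univ_prod_univ]
  · simp_rw [← Measure.prod_restrict]
    have hX := isCompact_compactCovering X n
    have hY := isCompact_compactCovering Y n
    have h1 : ∀ a, IsFiniteMeasure ((κ a).restrict (compactCovering X n)) :=
      fun a => ⟨by simpa using hX.measure_lt_top⟩
    have h2 : ∀ a, IsFiniteMeasure ((η a).restrict (compactCovering Y n)) :=
      fun a => ⟨by simpa using hY.measure_lt_top⟩
    have key : ∀ s t, MeasurableSet s → MeasurableSet t → Measurable fun a =>
        ((κ a).restrict (compactCovering X n)).prod ((η a).restrict (compactCovering Y n))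
          (s ×ˢ t) := by
      intro s t hs ht
      simp_rw [Measure.prod_prod, Measure.restrict_apply hs, Measure.restrict_apply ht]
      exact ((Measure.measurable_coe (hs.inter hX.measurableSet)).comp hκ).mul
        ((Measure.measurable_coe (ht.inter hY.measurableSet)).comp hη)
    refine Measurable.measure_of_isPiSystem generateFrom_prod.symm isPiSystem_prod ?_ ?_
    · rintro _ ⟨s, hs, t, ht, rfl⟩
      exact key s t hs ht
    · rw [← univ_prod_univ]
      exact key _ _ MeasurableSet.univ MeasurableSet.univ

section QuasiInvariance

variable {K : Type*} [MeasurableSpace K] [ArrowGroupoid K]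

/-- The measure `ν = ∫ λᵘ dμ(u)` on a groupoid induced by a family of measures `λᵘ` and a measure
`μ` on the unit space. -/
noncomputable def inducedMeasure (lam : UnitSpace K → Measure K) (μ : Measure (UnitSpace K)) :
    Measure K := μ.bind lam

/-- `μ` is quasi-invariant: `ν` and its image `ν⁻¹` under inversion are equivalent. -/
def QuasiInvariant (lam : UnitSpace K → Measure K) (μ : Measure (UnitSpace K)) : Prop :=
  inducedMeasure lam μ ≪ (inducedMeasure lam μ).map inv ∧
    (inducedMeasure lam μ).map inv ≪ inducedMeasure lam μ

/-- `Δ` is a modular function for `μ`: a Borel homomorphism into the multiplicative group of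
positive reals with `dν = Δ dν⁻¹`. -/
structure IsModularFunction (lam : UnitSpace K → Measure K) (μ : Measure (UnitSpace K))
    (Δ : K → ℝ) : Prop where
  measurable : Measurable Δ
  pos : ∀ x, 0 < Δ x
  map_mul : ∀ x y (h : src x = rng y), Δ (mul x y h) = Δ x * Δ y
  density : inducedMeasure lam μ =
    ((inducedMeasure lam μ).map inv).withDensity fun x => ENNReal.ofReal (Δ x)

end QuasiInvariance

/-! ### Actions by isomorphisms -/

/-- A continuous left action of a groupoid `G` on a groupoid `H` by isomorphisms: the moment map
`ρ : H → G⁽⁰⁾` is a groupoid bundle (a continuous open surjection whose fibres are subgroupoids),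
`x · h` is defined when `s(x) = ρ(h)`, and `h ↦ x · h` is a groupoid isomorphism from the fibre
over `s(x)` onto the fibre over `r(x)` (its inverse is `h ↦ x⁻¹ · h`). -/
structure IsoAction (G H : Type*) [TopologicalSpace G] [ArrowGroupoid G]
    [TopologicalSpace H] [ArrowGroupoid H] where
  moment : H → UnitSpace G
  continuous_moment : Continuous moment
  isOpenMap_moment : IsOpenMap moment
  surjective_moment : Function.Surjective moment
  moment_mul : ∀ h k (e : src h = rng k), moment h = moment k → moment (mul h k e) = moment h
  moment_inv : ∀ h, moment (inv h) = moment h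
  act : (x : G) → (h : H) → src x = (moment h).1 → H
  continuous_act : Continuous fun p : {p : G × H // src p.1 = (moment p.2).1} =>
    act p.1.1 p.1.2 p.2
  moment_act : ∀ x h e, moment (act x h e) = rngUnit x
  unit_act : ∀ h, act (moment h).1 h (src_of_unit (moment h).2) = h
  act_act : ∀ x y h (exy : src x = rng y) (e : src y = (moment h).1),
    act x (act y h e) (exy.trans (congrArg Subtype.val (moment_act y h e)).symm) =
      act (mul x y exy) h ((src_mul x y exy).trans e)
  act_mul : ∀ x h k (e : src h = rng k) (eh : src x = (moment h).1) (ek : src x = (moment k).1),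
    ∃ e' : src (act x h eh) = rng (act x k ek),
      act x (mul h k e) (eh.trans (congrArg Subtype.val
        (moment_mul h k e (Subtype.ext (eh.symm.trans ek)))).symm) =
        mul (act x h eh) (act x k ek) e'

namespace IsoAction

variable {G H : Type*} [TopologicalSpace G] [ArrowGroupoid G]
    [TopologicalSpace H] [ArrowGroupoid H] (α : IsoAction G H)

theorem act_congr {x x' : G} {h h' : H} (hx : x = x') (hh : h = h') (e : src x = (α.moment h).1)
    (e' : src x' = (α.moment h').1) : α.act x h e = α.act x' h' e' := by
  subst hx; subst hh; rfl

theorem moment_rng (h : H) : α.moment (rng h) = α.moment h := by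
  rw [← mul_inv_eq h]
  exact α.moment_mul h (inv h) _ (α.moment_inv h).symm

theorem moment_src (h : H) : α.moment (src h) = α.moment h := by
  rw [← rng_inv h, α.moment_rng, α.moment_inv]

theorem rng_act_unit (x : G) (v : H) (hv : rng v = v) (e : src x = (α.moment v).1) :
    rng (α.act x v e) = α.act x v e := by
  have hs : src v = rng v := (src_of_unit hv).trans hv.symm
  obtain ⟨e', h⟩ := α.act_mul x v v hs e e
  refine isUnit_of_mul_self e' (h.symm.trans ?_)
  exact α.act_congr rfl (mul_unit hs hv) _ _

theorem rng_act (x : G) (h : H) (e : src x = (α.moment h).1) :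
    rng (α.act x h e) = α.act x (rng h) (e.trans (congrArg Subtype.val (α.moment_rng h)).symm) := by
  obtain ⟨e', -⟩ := α.act_mul x (rng h) h (src_rng h)
    (e.trans (congrArg Subtype.val (α.moment_rng h)).symm) e
  rw [← e', src_of_unit (α.rng_act_unit x (rng h) (rng_rng h) _)]

theorem src_act (x : G) (h : H) (e : src x = (α.moment h).1) :
    src (α.act x h e) = α.act x (src h) (e.trans (congrArg Subtype.val (α.moment_src h)).symm) := by
  obtain ⟨e', -⟩ := α.act_mul x h (src h) (rng_src h).symm e
    (e.trans (congrArg Subtype.val (α.moment_src h)).symm)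
  rw [e', α.rng_act_unit x (src h) (rng_src h) _]

theorem act_of_unit {x : G} {h : H} (hx : rng x = x) (e : src x = (α.moment h).1) :
    α.act x h e = h :=
  (α.act_congr ((src_of_unit hx).symm.trans e) rfl _ _).trans (α.unit_act h)

theorem act_act_inv (x : G) (h : H) (e : src (inv x) = (α.moment h).1) :
    α.act x (α.act (inv x) h e)
      ((rng_inv x).symm.trans (congrArg Subtype.val (α.moment_act (inv x) h e)).symm) = h := by
  rw [α.act_act x (inv x) h (rng_inv x).symm e]
  refine α.act_of_unit ?_ _
  rw [rng_mul, mul_inv_eq]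

theorem act_inv (x : G) (h : H) (e : src x = (α.moment h).1) :
    α.act x (inv h) (e.trans (congrArg Subtype.val (α.moment_inv h)).symm) =
      inv (α.act x h e) := by
  obtain ⟨e', h1⟩ := α.act_mul x h (inv h) (rng_inv h).symm e
    (e.trans (congrArg Subtype.val (α.moment_inv h)).symm)
  refine eq_inv_of_mul_eq e' (h1.symm.trans ?_)
  rw [α.rng_act x h e]
  exact α.act_congr rfl (mul_inv_eq h) _ _

/-- The action on units: `x · v ∈ H⁽⁰⁾` for `v ∈ H⁽⁰⁾`. -/
def actUnit (x : G) (v : UnitSpace H) (e : src x = (α.moment v.1).1) : UnitSpace H :=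
  ⟨α.act x v.1 e, α.rng_act_unit x v.1 v.2 e⟩

/-- The Haar system on `H` is invariant under the action: `∫ f(x · h) dλᵛ(h) = ∫ f(h) dλ^{x·v}(h)`
for all `f ∈ C_c(H)`, whenever `x · v` is defined. -/
def Invariant [MeasurableSpace H] (lamH : HaarSystem H) : Prop :=
  ∀ (f : C_c(H, ℝ)) (x : G) (v : UnitSpace H) (e : src x = (α.moment v).1),
    ∫ h : {h : H // src x = (α.moment h).1}, f (α.act x h.1 h.2) ∂((lamH.meas v).comap Subtype.val) =
      ∫ h, f h ∂(lamH.meas (α.actUnit x v e))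

/-! ### The semidirect product and the subgroupoid of pairs whose first entry is a unit -/

/-- The semidirect product `H ⋊ G = {(h, x) : ρ(h) = r(x)}`. -/
def SemidirectProduct : Type _ := {p : H × G // (α.moment p.1).1 = rng p.2}

instance : TopologicalSpace α.SemidirectProduct :=
  inferInstanceAs (TopologicalSpace {p : H × G // (α.moment p.1).1 = rng p.2})

instance [MeasurableSpace G] [MeasurableSpace H] : MeasurableSpace α.SemidirectProduct :=
  inferInstanceAs (MeasurableSpace {p : H × G // (α.moment p.1).1 = rng p.2})

variable {α} in
/-- The element `(h, x)` of the semidirect product. -/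
def sdMk (h : H) (x : G) (e : (α.moment h).1 = rng x) : α.SemidirectProduct := ⟨(h, x), e⟩

variable {α} in
/-- First entry. -/
def fst (p : α.SemidirectProduct) : H := p.1.1

variable {α} in
/-- Second entry. -/
def snd (p : α.SemidirectProduct) : G := p.1.2

variable {α} in
theorem moment_fst (p : α.SemidirectProduct) : (α.moment (fst p)).1 = rng (snd p) := p.2

variable {α} in
theorem sd_ext {p q : α.SemidirectProduct} (h1 : fst p = fst q) (h2 : snd p = snd q) : p = q :=
  Subtype.ext (Prod.ext h1 h2)

variable {α} in
theorem src_inv_snd (p : α.SemidirectProduct) {h : H} (e : α.moment h = α.moment (fst p)) :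
    src (inv (snd p)) = (α.moment h).1 := by
  rw [src_inv, e, moment_fst]

/-- `r(h, x) = (r(h), r(x))`. -/
def sdRng (p : α.SemidirectProduct) : α.SemidirectProduct :=
  sdMk (rng (fst p)) (rng (snd p)) (by rw [α.moment_rng, moment_fst, rng_rng])

/-- `s(h, x) = (x⁻¹ · s(h), s(x))`. -/
def sdSrc (p : α.SemidirectProduct) : α.SemidirectProduct :=
  sdMk (α.act (inv (snd p)) (src (fst p)) (src_inv_snd p (α.moment_src _))) (src (snd p))
    (by rw [α.moment_act, rng_src]; exact rng_inv _)

/-- `(h, x)⁻¹ = (x⁻¹ · h⁻¹, x⁻¹)`. -/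
def sdInv (p : α.SemidirectProduct) : α.SemidirectProduct :=
  sdMk (α.act (inv (snd p)) (inv (fst p)) (src_inv_snd p (α.moment_inv _))) (inv (snd p))
    (by rw [α.moment_act]; rfl)

variable {α} in
theorem snd_composable {p q : α.SemidirectProduct} (h : α.sdSrc p = α.sdRng q) :
    src (snd p) = rng (snd q) := congrArg snd h

variable {α} in
theorem src_snd_eq_moment {p q : α.SemidirectProduct} (h : α.sdSrc p = α.sdRng q) :
    src (snd p) = (α.moment (fst q)).1 := by
  rw [moment_fst]; exact snd_composable h

variable {α} in
theorem fst_composable {p q : α.SemidirectProduct} (h : α.sdSrc p = α.sdRng q) :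
    src (fst p) = rng (α.act (snd p) (fst q) (src_snd_eq_moment h)) := by
  rw [α.rng_act]
  have h1 : α.act (inv (snd p)) (src (fst p)) (src_inv_snd p (α.moment_src _)) = rng (fst q) :=
    congrArg fst h
  rw [← α.act_act_inv (snd p) (src (fst p)) (src_inv_snd p (α.moment_src _))]
  exact α.act_congr rfl h1 _ _

/-- `(h, x)(k, y) = (h (x · k), x y)`. -/
def sdMul (p q : α.SemidirectProduct) (h : α.sdSrc p = α.sdRng q) : α.SemidirectProduct :=
  sdMk (mul (fst p) (α.act (snd p) (fst q) (src_snd_eq_moment h)) (fst_composable h))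
    (mul (snd p) (snd q) (snd_composable h))
    (by
      rw [α.moment_mul, rng_mul, moment_fst]
      rw [α.moment_act]
      exact Subtype.ext (moment_fst p))

instance : ArrowGroupoid α.SemidirectProduct where
  rng := α.sdRng
  src := α.sdSrc
  mul := α.sdMul
  inv := α.sdInv
  rng_rng p := sd_ext (rng_rng _) (rng_rng _)
  src_rng p := by
    refine sd_ext ?_ (src_rng _)
    refine (α.act_congr (inv_of_unit (rng_rng _)) (src_rng _) _ ?_).trans
      (α.act_of_unit (rng_rng _) ?_)
    all_goals
      rw [α.moment_rng, moment_fst, src_rng]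
  rng_src p := by
    refine sd_ext (α.rng_act_unit _ _ (rng_src _) _) (rng_src _)
  rng_mul p q h := sd_ext (rng_mul _ _ _) (rng_mul _ _ _)
  src_mul p q h := by
    refine sd_ext ?_ (src_mul _ _ _)
    have e0 : src (mul (fst p) (α.act (snd p) (fst q) (src_snd_eq_moment h)) (fst_composable h)) =
        α.act (snd p) (src (fst q)) ((src_snd_eq_moment h).trans
          (congrArg Subtype.val (α.moment_src _)).symm) := by
      rw [src_mul, α.src_act]
    have hc := snd_composable h
    have e1 : src (inv (mul (snd p) (snd q) hc)) = rng (snd p) := by rw [src_inv, rng_mul]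
    refine (α.act_congr rfl e0 _ (by rw [α.moment_act]; exact e1)).trans ?_
    refine (α.act_act _ _ _ e1 ((src_snd_eq_moment h).trans
          (congrArg Subtype.val (α.moment_src _)).symm)).trans ?_
    exact α.act_congr (inv_mul_mul _ _ hc e1) rfl _ _
  rng_inv p := by
    refine sd_ext ?_ (rng_inv _)
    exact (α.rng_act _ _ _).trans (α.act_congr rfl (rng_inv _) _ _)
  src_inv p := by
    refine sd_ext ?_ (src_inv _)
    have e := src_inv_snd p (α.moment_inv (fst p))
    have e2 : src (inv (snd p)) = (α.moment (src (inv (fst p)))).1 :=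
      e.trans (congrArg Subtype.val (α.moment_src _)).symm
    refine (α.act_congr (inv_inv_eq (snd p)) (α.src_act (inv (snd p)) (inv (fst p)) e) _
      ((rng_inv _).symm.trans (congrArg Subtype.val (α.moment_act _ _ e2)).symm)).trans ?_
    exact (α.act_act_inv (snd p) _ e2).trans (src_inv _)
  assoc_mul p q t hpq hqt := by
    refine sd_ext ?_ (assoc_mul _ _ _ _ _)
    have ep := src_snd_eq_moment hpq
    have eq := src_snd_eq_moment hqt
    have hx := snd_composable hpq
    have exy : src (snd p) = (α.moment (α.act (snd q) (fst t) eq)).1 :=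
      hx.trans (congrArg Subtype.val (α.moment_act _ _ eq)).symm
    obtain ⟨e', h1⟩ := α.act_mul (snd p) (fst q) (α.act (snd q) (fst t) eq) (fst_composable hqt)
      ep exy
    have h2 := α.act_act (snd p) (snd q) (fst t) hx eq
    have h3 := assoc_mul (fst p) (α.act (snd p) (fst q) ep) _ (fst_composable hpq) e'
    refine Eq.trans ?_ (h3.trans (mul_congr_arrow rfl h1.symm _ _))
    exact mul_congr_arrow rfl h2.symm _ _
  rng_mul_self p := by
    refine sd_ext ?_ (rng_mul_self _)
    refine (mul_congr_arrow rfl (α.act_of_unit (rng_rng _) ?_) _ (src_rng _)).trans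
      (rng_mul_self _)
  mul_src_self p := by
    refine sd_ext ?_ (mul_src_self _)
    exact (mul_congr_arrow rfl (α.act_act_inv _ _ (src_inv_snd p (α.moment_src _))) _
      (rng_src _).symm).trans (mul_src_self _)
  mul_inv_eq p := by
    refine sd_ext ?_ (mul_inv_eq _)
    exact (mul_congr_arrow rfl (α.act_act_inv _ _ (src_inv_snd p (α.moment_inv _))) _
      (rng_inv _).symm).trans (mul_inv_eq _)
  inv_mul_eq p := by
    refine sd_ext ?_ (inv_mul_eq _)
    obtain ⟨e', h1⟩ := α.act_mul (inv (snd p)) (inv (fst p)) (fst p) (src_inv _)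
      (src_inv_snd p (α.moment_inv _)) (src_inv_snd p rfl)
    exact h1.symm.trans (α.act_congr rfl (inv_mul_eq _) _ _)

/-- `G_ρ = {(v, x) ∈ H ⋊ G : v ∈ H⁽⁰⁾}`, a subgroupoid of the semidirect product. -/
def RhoGroupoid : Type _ := {p : α.SemidirectProduct // rng (fst p) = fst p}

instance : TopologicalSpace α.RhoGroupoid :=
  inferInstanceAs (TopologicalSpace {p : α.SemidirectProduct // rng (fst p) = fst p})

instance [MeasurableSpace G] [MeasurableSpace H] : MeasurableSpace α.RhoGroupoid :=
  inferInstanceAs (MeasurableSpace {p : α.SemidirectProduct // rng (fst p) = fst p})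

variable {α} in
/-- The inclusion of `G_ρ` into the semidirect product. -/
def rhoIncl (p : α.RhoGroupoid) : α.SemidirectProduct := p.1

variable {α} in
/-- The element `(v, x)` of `G_ρ`. -/
def rhoMk (v : UnitSpace H) (x : G) (e : (α.moment v.1).1 = rng x) : α.RhoGroupoid :=
  ⟨sdMk v.1 x e, v.2⟩

variable {α} in
theorem rho_ext {p q : α.RhoGroupoid} (h : rhoIncl p = rhoIncl q) : p = q := Subtype.ext h

instance : ArrowGroupoid α.RhoGroupoid where
  rng p := ⟨rng (rhoIncl p), rng_rng _⟩
  src p := ⟨src (rhoIncl p), α.rng_act_unit _ _ (rng_src _) _⟩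
  mul p q h := ⟨mul (rhoIncl p) (rhoIncl q) (congrArg rhoIncl h), by
    have hv : rng (fst (rhoIncl p)) = fst (rhoIncl p) := p.2
    refine (rng_mul _ _ _).trans (hv.trans ?_)
    exact (mul_unit (fst_composable (congrArg rhoIncl h))
      (α.rng_act_unit (snd (rhoIncl p)) (fst (rhoIncl q)) q.2 _)).symm⟩
  inv p := ⟨inv (rhoIncl p), α.rng_act_unit _ _
    ((rng_inv _).trans ((src_of_unit p.2).trans (inv_of_unit p.2).symm)) _⟩
  rng_rng _ := rho_ext (rng_rng _)
  src_rng _ := rho_ext (src_rng _)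
  rng_src _ := rho_ext (rng_src _)
  rng_mul _ _ _ := rho_ext (rng_mul _ _ _)
  src_mul _ _ _ := rho_ext (src_mul _ _ _)
  rng_inv _ := rho_ext (rng_inv _)
  src_inv _ := rho_ext (src_inv _)
  assoc_mul _ _ _ hxy hyz :=
    rho_ext (assoc_mul _ _ _ (congrArg rhoIncl hxy) (congrArg rhoIncl hyz))
  rng_mul_self _ := rho_ext (rng_mul_self _)
  mul_src_self _ := rho_ext (mul_src_self _)
  mul_inv_eq _ := rho_ext (mul_inv_eq _)
  inv_mul_eq _ := rho_ext (inv_mul_eq _)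

/-! ### Unit spaces: both unit spaces are identified with `H⁽⁰⁾` -/

/-- The identification `v ↦ (v, ρ(v))` of `H⁽⁰⁾` with the unit space of `H ⋊ G`. -/
def sdUnit (v : UnitSpace H) : UnitSpace α.SemidirectProduct :=
  ⟨sdMk v.1 (α.moment v.1).1 (α.moment v.1).2.symm, sd_ext v.2 (α.moment v.1).2⟩

/-- The identification `v ↦ (v, ρ(v))` of `H⁽⁰⁾` with the unit space of `G_ρ`. -/
def rhoUnit (v : UnitSpace H) : UnitSpace α.RhoGroupoid :=
  ⟨⟨(α.sdUnit v).1, v.2⟩, rho_ext (α.sdUnit v).2⟩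

variable {α} in
/-- The `H⁽⁰⁾`-coordinate of a unit of `H ⋊ G`. -/
def sdUnitFst (w : UnitSpace α.SemidirectProduct) : UnitSpace H := ⟨fst w.1, congrArg fst w.2⟩

variable {α} in
/-- The `G⁽⁰⁾`-coordinate of a unit of `H ⋊ G`. -/
def sdUnitSnd (w : UnitSpace α.SemidirectProduct) : UnitSpace G := ⟨snd w.1, congrArg snd w.2⟩

variable {α} in
/-- A unit of `G_ρ`, as a unit of `H ⋊ G`. -/
def rhoUnitIncl (w : UnitSpace α.RhoGroupoid) : UnitSpace α.SemidirectProduct :=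
  ⟨rhoIncl w.1, congrArg rhoIncl w.2⟩

/-! ### Haar systems on `H ⋊ G` and on `G_ρ` -/

section Families

variable [MeasurableSpace G] [MeasurableSpace H]

/-- The Haar system `dλ^{(v,u)}(h, x) = dλ_H^v(h) dλ_G^u(x)` of `H ⋊ G`. -/
noncomputable def sdHaar (lamG : HaarSystem G) (lamH : HaarSystem H)
    (w : UnitSpace α.SemidirectProduct) : Measure α.SemidirectProduct :=
  ((lamH.meas (sdUnitFst w)).prod (lamG.meas (sdUnitSnd w))).comap fun p => (fst p, snd p)

/-- The Haar system `∫ f dσ^v = ∫ f(v, x) dλ_G^{ρ(v)}(x)` of `G_ρ`. -/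
noncomputable def rhoHaar (lamG : HaarSystem G)
    (w : UnitSpace α.RhoGroupoid) : Measure α.RhoGroupoid :=
  ((Measure.dirac (sdUnitFst (rhoUnitIncl w)).1).prod (lamG.meas (sdUnitSnd (rhoUnitIncl w)))).comap
    fun p => (fst (rhoIncl p), snd (rhoIncl p))

section Measurability

theorem measurable_sdUnit [BorelSpace G] [BorelSpace H] : Measurable α.sdUnit := by
  have h : Measurable fun v : UnitSpace H => (α.moment v.1).1 :=
    (measurable_subtype_coe.comp α.continuous_moment.measurable).comp measurable_subtype_coe
  exact ((measurable_subtype_coe.prodMk h).subtype_mk).subtype_mk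

theorem measurable_rhoUnit [BorelSpace G] [BorelSpace H] : Measurable α.rhoUnit :=
  ((measurable_subtype_coe.comp α.measurable_sdUnit).subtype_mk).subtype_mk

theorem isClosedEmbedding_sd [T2Space G] [OpenTopGroupoid G] :
    IsClosedEmbedding fun p : α.SemidirectProduct => (fst p, snd p) := by
  refine IsClosed.isClosedEmbedding_subtypeVal (isClosed_eq ?_ ?_)
  · exact (continuous_subtype_val.comp α.continuous_moment).comp continuous_fst
  · exact OpenTopGroupoid.continuous_rng.comp continuous_snd

theorem isClosedEmbedding_rhoIncl [T2Space H] [OpenTopGroupoid H] :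
    IsClosedEmbedding (rhoIncl : α.RhoGroupoid → α.SemidirectProduct) := by
  have h : Continuous (fst : α.SemidirectProduct → H) :=
    continuous_fst.comp continuous_subtype_val
  exact IsClosed.isClosedEmbedding_subtypeVal
    (isClosed_eq (OpenTopGroupoid.continuous_rng.comp h) h)

instance [BorelSpace G] [BorelSpace H] [SecondCountableTopology G] [SecondCountableTopology H] :
    BorelSpace α.SemidirectProduct :=
  inferInstanceAs (BorelSpace {p : H × G // (α.moment p.1).1 = rng p.2})

instance [BorelSpace G] [BorelSpace H] [SecondCountableTopology G] [SecondCountableTopology H] :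
    BorelSpace α.RhoGroupoid :=
  inferInstanceAs (BorelSpace {p : α.SemidirectProduct // rng (fst p) = fst p})

theorem continuous_inv_sd [OpenTopGroupoid G] [OpenTopGroupoid H] :
    Continuous (inv : α.SemidirectProduct → α.SemidirectProduct) := by
  have h1 : Continuous (fst : α.SemidirectProduct → H) :=
    continuous_fst.comp continuous_subtype_val
  have h2 : Continuous (snd : α.SemidirectProduct → G) :=
    continuous_snd.comp continuous_subtype_val
  have h3 : Continuous fun p : α.SemidirectProduct => inv (snd p) :=
    OpenTopGroupoid.continuous_inv.comp h2
  have h4 : Continuous fun p : α.SemidirectProduct => inv (fst p) :=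
    OpenTopGroupoid.continuous_inv.comp h1
  have h5 := α.continuous_act.comp (Continuous.subtype_mk (h3.prodMk h4)
    fun p => src_inv_snd p (α.moment_inv _))
  exact Continuous.subtype_mk (h5.prodMk h3) _

theorem continuous_inv_rho [OpenTopGroupoid G] [OpenTopGroupoid H] :
    Continuous (inv : α.RhoGroupoid → α.RhoGroupoid) :=
  Continuous.subtype_mk (α.continuous_inv_sd.comp continuous_subtype_val) _

variable [BorelSpace G] [LocallyCompactSpace G] [T2Space G] [SecondCountableTopology G]
  [OpenTopGroupoid G]
  [BorelSpace H] [LocallyCompactSpace H] [T2Space H] [SecondCountableTopology H]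

theorem measurableEmbedding_sd :
    MeasurableEmbedding fun p : α.SemidirectProduct => (fst p, snd p) :=
  α.isClosedEmbedding_sd.measurableEmbedding

theorem measurableEmbedding_rho [OpenTopGroupoid H] :
    MeasurableEmbedding fun p : α.RhoGroupoid => (fst (rhoIncl p), snd (rhoIncl p)) :=
  (α.isClosedEmbedding_sd.comp α.isClosedEmbedding_rhoIncl).measurableEmbedding

theorem _root_.measurable_comap_meas {A X Y : Type*} [MeasurableSpace A] [MeasurableSpace X]
    [MeasurableSpace Y] {κ : A → Measure Y} (hκ : Measurable κ) {f : X → Y}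
    (hf : MeasurableEmbedding f) : Measurable fun a => (κ a).comap f := by
  refine Measure.measurable_of_measurable_coe _ fun s hs => ?_
  simp_rw [hf.comap_apply]
  exact (Measure.measurable_coe (hf.measurableSet_image.2 hs)).comp hκ

/-- The Haar system of `H ⋊ G` depends measurably on the unit. -/
theorem measurable_sdHaar (lamG : HaarSystem G) (lamH : HaarSystem H) :
    Measurable (α.sdHaar lamG lamH) := by
  have h1 : Measurable (sdUnitFst : UnitSpace α.SemidirectProduct → UnitSpace H) :=
    (measurable_fst.comp (measurable_subtype_coe.comp measurable_subtype_coe)).subtype_mk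
  have h2 : Measurable (sdUnitSnd : UnitSpace α.SemidirectProduct → UnitSpace G) :=
    (measurable_snd.comp (measurable_subtype_coe.comp measurable_subtype_coe)).subtype_mk
  exact measurable_comap_meas (measurable_prod_meas (κ := fun w => lamH.meas (sdUnitFst w))
    (η := fun w => lamG.meas (sdUnitSnd w)) (lamH.measurable_meas.comp h1)
    (lamG.measurable_meas.comp h2)) α.measurableEmbedding_sd

/-- The Haar system of `G_ρ` depends measurably on the unit. -/
theorem measurable_rhoHaar [OpenTopGroupoid H] (lamG : HaarSystem G) :
    Measurable (α.rhoHaar lamG) := by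
  have h0 : Measurable (rhoUnitIncl : UnitSpace α.RhoGroupoid → UnitSpace α.SemidirectProduct) :=
    (measurable_subtype_coe.comp measurable_subtype_coe).subtype_mk
  have h1 : Measurable fun w : UnitSpace α.RhoGroupoid => (sdUnitFst (rhoUnitIncl w)).1 :=
    (measurable_fst.comp (measurable_subtype_coe.comp measurable_subtype_coe)).comp h0
  have h2 : Measurable fun w : UnitSpace α.RhoGroupoid => sdUnitSnd (rhoUnitIncl w) :=
    (measurable_snd.comp (measurable_subtype_coe.comp measurable_subtype_coe)).subtype_mk.comp h0
  exact measurable_comap_meas (measurable_prod_meas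
    (κ := fun w : UnitSpace α.RhoGroupoid => Measure.dirac (sdUnitFst (rhoUnitIncl w)).1)
    (η := fun w => lamG.meas (sdUnitSnd (rhoUnitIncl w))) (Measure.measurable_dirac.comp h1)
    (lamG.measurable_meas.comp h2)) α.measurableEmbedding_rho

end Measurability

end Families

end IsoAction

/-!
Write `d` for the restriction of `Δ` to `G_ρ` and `Δ_H` for its restriction to `H`. Since
`(h, x) = (h, ρ(h)) (s(h), x)`, the homomorphism property gives `Δ(h, x) = Δ_H(h) d(s(h), x)`
everywhere. What has to be shown is that the two restrictions are the densities on `H` and on `G_ρ`;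
quasi-invariance then follows, as the densities are positive. All integrals are lower Lebesgue
integrals of nonnegative Borel functions, so Fubini is available without integrability questions;
the invariance properties, assumed for `C_c`, extend to such functions because measures finite on
compact sets are determined by `C_c` (`map_eq_of_integral_subtype_eq`).

In `∫ F dν = ∫ F(p⁻¹) Δ(p⁻¹) dν(p)` on `H ⋊ G`, substitute `h = x · k`, which is allowed by the
invariance of the Haar system of `H`. Because `(x · k, x)⁻¹ = (k⁻¹, x⁻¹)`, the two factors of `Δ`
separate (`IsoAction.splitDensity`): the right side is an integral over `(x⁻¹ · v, x⁻¹)` with weight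
`d` followed by an integral over `k⁻¹` with weight `Δ_H`. Choosing `F` so that the second integral
is `1` shows that the image of `∫ σᵛ dμ(v)` under inversion, multiplied by `d`, has the form
`∫ σᵛ dμ'(v)` for some measure `μ'` on the units (`IsoAction.SplitDensity.exists_rhoIntertwines`).
Inserting this again, with the integral over `G` normalized, gives `ν_H(μ) = Δ_H ν_H(μ')⁻¹`
(`IsoAction.SplitDensity.intertwines`), where `ν_H(μ) = ∫ λ_Hᵛ dμ(v)`.

It remains to prove `μ' = μ`, and the last identity alone implies it (`HaarSystem.Intertwines.eq`).
The integral over pairs `(x, y)` in `H` with a common range carries an action of the symmetric group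
on three letters, twisted by `Δ_H`. One transposition exchanges the pair integrals for `μ` and `μ'`,
another one preserves both; the braid relation `ASA = SAS` then forces the pair integrals, hence the
measures, to agree.
-/

/-! ### Borel functions, and measures determined by continuous functions -/

theorem measurable_dite_of_isClosed {X Y : Type*} [TopologicalSpace X] [MeasurableSpace X]
    [BorelSpace X] [MeasurableSpace Y]
    {p : X → Prop} [DecidablePred p] (hp : IsClosed {x | p x}) {g : {x // p x} → Y}
    (hg : Measurable g) {j : X → Y} (hj : Measurable j) :
    Measurable fun x => if h : p x then g ⟨x, h⟩ else j x :=
  Measurable.dite (s := {x | p x}) hg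
    (g := fun x => j x) (hj.comp measurable_subtype_coe) hp.measurableSet

/-- A change of variables `g : s → t` between closed sets that holds for integrals of functions
in `C_c` holds for measures. The function `T` is a Borel extension of `g` to the whole space. The
continuous left inverse `g'` makes `g` proper, so that the image measure is again finite on
compact sets. -/
theorem map_eq_of_integral_subtype_eq {X : Type*} [TopologicalSpace X] [LocallyCompactSpace X]
    [T2Space X] [SecondCountableTopology X] [MeasurableSpace X] [BorelSpace X]
    {κ₁ κ₂ : Measure X} [IsFiniteMeasureOnCompacts κ₁] [IsFiniteMeasureOnCompacts κ₂]
    {s t : Set X} (hs : IsClosed s) (ht : IsClosed t) (hκ : ∀ᵐ y ∂κ₁, y ∈ s)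
    {g : s → X} {g' : t → X} (hg' : Continuous g')
    (hgt : ∀ y, g y ∈ t) (hinv : ∀ y, g' ⟨g y, hgt y⟩ = y)
    {T : X → X} (hT : Measurable T) (hTg : ∀ y : s, T y = g y)
    (h : ∀ f : C_c(X, ℝ), ∫ y : s, f (g y) ∂(κ₁.comap Subtype.val) = ∫ y, f y ∂κ₂) :
    κ₁.map T = κ₂ := by
  let _ := TopologicalSpace.metrizableSpaceMetric X
  have : IsFiniteMeasureOnCompacts (κ₁.map T) := by
    refine ⟨fun K hK => ?_⟩
    have hK' : IsCompact (g' '' (Subtype.val ⁻¹' K)) :=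
      (ht.isClosedEmbedding_subtypeVal.isCompact_preimage hK).image hg'
    rw [Measure.map_apply hT hK.measurableSet]
    refine lt_of_le_of_lt (measure_mono_ae ?_) hK'.measure_lt_top
    filter_upwards [hκ] with y hy hyK
    have hyK' : g ⟨y, hy⟩ ∈ K := by rw [← hTg]; exact hyK
    exact ⟨⟨g ⟨y, hy⟩, hgt _⟩, hyK', hinv ⟨y, hy⟩⟩
  refine Measure.ext_of_integral_eq_on_compactlySupported fun f => ?_
  rw [← h f, integral_map hT.aemeasurable (map_continuous f).aestronglyMeasurable]
  simp_rw [← hTg]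
  rw [integral_subtype_comap hs.measurableSet fun y => f (T y),
    Measure.restrict_eq_self_of_ae_mem hκ]

namespace ArrowGroupoid

variable {X : Type*} [ArrowGroupoid X]

open Classical in
/-- The product of a groupoid as a function on all pairs, with value `y` at a pair `(x, y)` that is
not composable. -/
noncomputable def mulT (x y : X) : X := if h : src x = rng y then mul x y h else y

theorem mulT_of {x y : X} (h : src x = rng y) : mulT x y = mul x y h := dif_pos h

theorem inv_mulT_mulT {x y : X} (h : src x = rng y) : mulT (inv x) (mulT x y) = y := by
  have e : src (inv x) = rng (mul x y h) := (src_inv x).trans (rng_mul x y h).symm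
  rw [mulT_of h, mulT_of e, ← assoc_mul (inv x) x y (src_inv x) h]
  exact (mul_congr_arrow ((inv_mul_eq x).trans h) rfl _ (src_rng y)).trans (rng_mul_self y)

theorem mulT_inv_self (x : X) : mulT x (inv x) = rng x := by
  rw [mulT_of (rng_inv x).symm, mul_inv_eq]

theorem mulT_src_self (x : X) : mulT x (src x) = x := by
  rw [mulT_of (rng_src x).symm, mul_src_self]

theorem rng_mulT {x y : X} (h : src x = rng y) : rng (mulT x y) = rng x := by
  rw [mulT_of h, rng_mul]

theorem inv_mulT {x y : X} (h : src x = rng y) : inv (mulT x y) = mulT (inv y) (inv x) := by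
  have e : src (inv y) = rng (inv x) := by rw [src_inv, rng_inv, h]
  have e2 : src (mulT x y) = rng (mul (inv y) (inv x) e) := by
    rw [mulT_of h, src_mul, rng_mul, rng_inv]
  rw [mulT_of e]
  refine (eq_inv_of_mul_eq e2 ?_).symm
  have e3 : src y = rng (mul (inv y) (inv x) e) := by rw [rng_mul, rng_inv]
  have e4 : src (mul x y h) = rng (mul (inv y) (inv x) e) := by rw [← e2, mulT_of h]
  have h1 : mul y (mul (inv y) (inv x) e) e3 = inv x := by
    rw [← assoc_mul y (inv y) (inv x) (rng_inv y).symm e]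
    exact (mul_congr_arrow ((mul_inv_eq y).trans (h.symm.trans (rng_inv x).symm)) rfl _
      (src_rng _)).trans (rng_mul_self _)
  rw [rng_mulT h]
  calc mul (mulT x y) (mul (inv y) (inv x) e) e2
      = mul (mul x y h) (mul (inv y) (inv x) e) e4 := mul_congr_arrow (mulT_of h) rfl _ _
    _ = mul x (mul y (mul (inv y) (inv x) e) e3) (h.trans (rng_mul _ _ _).symm) :=
        assoc_mul x y _ h e3
    _ = mul x (inv x) (rng_inv x).symm := mul_congr_arrow rfl h1 _ _
    _ = rng x := mul_inv_eq x

theorem mulT_mulT_inv {x y : X} (h : src x = rng y) : mulT (mulT x y) (inv y) = x := by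
  have h1 : src (mulT x y) = rng (inv y) := by rw [mulT_of h, src_mul, rng_inv]
  have h2 : src (inv y) = rng (inv x) := by rw [src_inv, rng_inv, h]
  rw [← inv_inv_eq (mulT _ _), inv_mulT h1, inv_mulT h, inv_mulT_mulT h2, inv_inv_eq]

theorem srcUnit_inv (x : X) : srcUnit (inv x) = rngUnit x := Subtype.ext (src_inv x)

theorem rngUnit_unit (u : UnitSpace X) : rngUnit u.1 = u := Subtype.ext u.2

variable [TopologicalSpace X] [T2Space X] [SecondCountableTopology X] [MeasurableSpace X]
  [BorelSpace X] [OpenTopGroupoid X]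

theorem measurable_mulT : Measurable fun p : X × X => mulT p.1 p.2 := by
  classical
  exact measurable_dite_of_isClosed (p := fun p : X × X => src p.1 = rng p.2)
    (isClosed_eq (OpenTopGroupoid.continuous_src.comp continuous_fst)
      (OpenTopGroupoid.continuous_rng.comp continuous_snd))
    OpenTopGroupoid.continuous_mul.measurable measurable_snd

theorem measurable_arrowInv : Measurable (inv : X → X) := OpenTopGroupoid.continuous_inv.measurable

theorem measurable_rngUnit : Measurable (rngUnit : X → UnitSpace X) :=
  OpenTopGroupoid.continuous_rng.measurable.subtype_mk

theorem measurable_srcUnit : Measurable (srcUnit : X → UnitSpace X) :=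
  OpenTopGroupoid.continuous_src.measurable.subtype_mk

end ArrowGroupoid

/-! ### Haar systems as s-finite kernels -/

namespace HaarSystem

open ProbabilityTheory

variable {X : Type*} [TopologicalSpace X] [LocallyCompactSpace X] [T2Space X]
  [SecondCountableTopology X] [MeasurableSpace X] [BorelSpace X] [ArrowGroupoid X]
  (lam : HaarSystem X)

theorem ae_rngUnit (u : UnitSpace X) : ∀ᵐ y ∂lam.meas u, rngUnit y = u := by
  have h : ∀ᵐ y ∂lam.meas u, y ∈ (lam.meas u).support := Measure.support_mem_ae
  rw [lam.support_eq u] at h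
  filter_upwards [h] with y hy
  exact Subtype.ext hy

theorem meas_ne_zero (u : UnitSpace X) : lam.meas u ≠ 0 := by
  intro h
  have h1 : u.1 ∈ (lam.meas u).support := by rw [lam.support_eq u]; exact u.2
  rw [h, Measure.support_zero] at h1
  exact h1

/-- Left invariance, for all nonnegative Borel functions. -/
theorem lintegral_mulT [OpenTopGroupoid X] (x : X) {f : X → ℝ≥0∞} (hf : Measurable f) :
    ∫⁻ y, f (mulT x y) ∂lam.meas (srcUnit x) = ∫⁻ y, f y ∂lam.meas (rngUnit x) := by
  have hc : ∀ z : X, Continuous fun y : {y : X // src z = rng y} => mul z y.1 y.2 := fun z =>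
    OpenTopGroupoid.continuous_mul.comp
      (Continuous.subtype_mk (continuous_const.prodMk continuous_subtype_val) fun y => y.2)
  have hcl : ∀ z : X, IsClosed {y : X | src z = rng y} := fun z =>
    isClosed_eq continuous_const OpenTopGroupoid.continuous_rng
  have hm : Measurable (mulT x) := measurable_mulT.comp (measurable_const.prodMk measurable_id)
  have key := map_eq_of_integral_subtype_eq (κ₁ := lam.meas (srcUnit x))
    (κ₂ := lam.meas (rngUnit x)) (hcl x) (hcl (inv x))
    ((lam.ae_rngUnit (srcUnit x)).mono fun y hy => (congrArg Subtype.val hy).symm)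
    (hc (inv x)) (fun y => (src_inv x).trans (rng_mul x y.1 y.2).symm)
    (fun y => by
      have e := inv_mulT_mulT y.2
      rwa [mulT_of y.2, mulT_of ((src_inv x).trans (rng_mul x y.1 y.2).symm)] at e)
    hm (fun y => mulT_of y.2) (fun f => lam.left_invariant f x)
  rw [← key, lintegral_map hf hm]

/-- A weight that normalizes a Haar system: a Borel function `b : X → (0, ∞)` with
`∫ b dλᵘ = 1` for every unit `u`. -/
theorem exists_weight [OpenTopGroupoid X] : ∃ b : X → ℝ≥0∞, Measurable b ∧ (∀ x, b x ≠ 0) ∧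
    (∀ x, b x ≠ ∞) ∧ ∀ u, ∫⁻ x, b x ∂lam.meas u = 1 := by
  let K := compactCovering X
  have hK : ∀ n, MeasurableSet (K n) := fun n => (isCompact_compactCovering X n).measurableSet
  have hfin : ∀ n u, lam.meas u (K n) ≠ ∞ := fun n u =>
    (isCompact_compactCovering X n).measure_lt_top.ne
  -- With these coefficients the `n`-th term of `b₀` below is at most `2⁻ⁿ`, both pointwise and in
  -- its integral against `λᵘ`.
  let w : ℕ → UnitSpace X → ℝ≥0∞ := fun n u => (1 / 2) ^ n * (1 + lam.meas u (K n))⁻¹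
  have hw : ∀ n, Measurable (w n) := fun n =>
    (((Measure.measurable_coe (hK n)).comp lam.measurable_meas).const_add 1).inv.const_mul _
  have hw0 : ∀ n u, w n u ≠ 0 := fun n u => by
    have := hfin n u
    simp [w, this]
  have hw1 : ∀ n u, w n u ≤ (1 / 2) ^ n := fun n u =>
    mul_le_of_le_one_right' (ENNReal.inv_le_one.2 le_self_add)
  have hwK : ∀ n u, w n u * lam.meas u (K n) ≤ (1 / 2) ^ n := fun n u => by
    rw [mul_assoc]
    refine mul_le_of_le_one_right' ?_
    calc (1 + lam.meas u (K n))⁻¹ * lam.meas u (K n)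
        ≤ (1 + lam.meas u (K n))⁻¹ * (1 + lam.meas u (K n)) := by gcongr; exact le_add_self
      _ ≤ 1 := ENNReal.inv_mul_le_one _
  have hsum : ∑' n : ℕ, (1 / 2 : ℝ≥0∞) ^ n ≠ ∞ := by
    rw [ENNReal.tsum_geometric, one_div, ENNReal.one_sub_inv_two, inv_inv]
    exact ENNReal.ofNat_ne_top
  let b₀ : X → ℝ≥0∞ := fun x => ∑' n, (K n).indicator (fun x => w n (rngUnit x)) x
  have hb₀ : Measurable b₀ :=
    Measurable.tsum fun n => ((hw n).comp measurable_rngUnit).indicator (hK n)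
  have hb₀0 : ∀ x, b₀ x ≠ 0 := by
    intro x h
    obtain ⟨n, hn⟩ := exists_mem_compactCovering x
    have := ENNReal.tsum_eq_zero.1 h n
    rw [indicator_of_mem hn] at this
    exact hw0 _ _ this
  have hb₀t : ∀ x, b₀ x ≠ ∞ := fun x =>
    ne_top_of_le_ne_top hsum (ENNReal.tsum_le_tsum fun n =>
      (indicator_le_self _ _ _).trans (hw1 _ _))
  let c : UnitSpace X → ℝ≥0∞ := fun u => ∫⁻ x, b₀ x ∂lam.meas u
  have hc : Measurable c := (Measure.measurable_lintegral hb₀).comp lam.measurable_meas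
  have hc0 : ∀ u, c u ≠ 0 := by
    intro u h
    have h1 := (lintegral_eq_zero_iff hb₀).1 h
    refine lam.meas_ne_zero u (Measure.measure_univ_eq_zero.1 ?_)
    refine measure_mono_null (fun x _ => ?_) h1
    exact hb₀0 x
  have hct : ∀ u, c u ≠ ∞ := by
    intro u
    refine ne_top_of_le_ne_top hsum ?_
    calc c u = ∑' n, ∫⁻ x, (K n).indicator (fun x => w n (rngUnit x)) x ∂lam.meas u :=
          lintegral_tsum fun n => (((hw n).comp measurable_rngUnit).indicator (hK n)).aemeasurable
      _ = ∑' n, w n u * lam.meas u (K n) := by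
          congr with n
          rw [← lintegral_indicator_const (hK n)]
          refine lintegral_congr_ae ((lam.ae_rngUnit u).mono fun x hx => ?_)
          by_cases h : x ∈ K n <;> simp [h, hx]
      _ ≤ _ := ENNReal.tsum_le_tsum fun n => hwK n u
  refine ⟨fun x => b₀ x * (c (rngUnit x))⁻¹, hb₀.mul (hc.comp measurable_rngUnit).inv,
    fun x => mul_ne_zero (hb₀0 x) (ENNReal.inv_ne_zero.2 (hct _)),
    fun x => ENNReal.mul_ne_top (hb₀t x) (ENNReal.inv_ne_top.2 (hc0 _)), fun u => ?_⟩
  calc ∫⁻ x, b₀ x * (c (rngUnit x))⁻¹ ∂lam.meas u = ∫⁻ x, b₀ x * (c u)⁻¹ ∂lam.meas u :=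
        lintegral_congr_ae ((lam.ae_rngUnit u).mono fun x hx => by simp only [hx])
    _ = c u * (c u)⁻¹ := lintegral_mul_const _ hb₀
    _ = 1 := ENNReal.mul_inv_cancel (hc0 u) (hct u)

/-- A Haar system as a kernel from units to arrows. -/
noncomputable def kernel : Kernel (UnitSpace X) X := ⟨lam.meas, lam.measurable_meas⟩

/-- The kernel of a Haar system has an everywhere finite density with respect to the Markov kernel
`b dλᵘ`, where `b` is a normalizing weight. -/
instance [OpenTopGroupoid X] : IsSFiniteKernel lam.kernel := by
  obtain ⟨b, hb, hb0, hbt, hb1⟩ := lam.exists_weight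
  have hm : Measurable fun u => (lam.meas u).withDensity b := by
    refine Measure.measurable_of_measurable_coe _ fun s hs => ?_
    simp_rw [withDensity_apply _ hs, ← lintegral_indicator hs]
    exact (Measure.measurable_lintegral (hb.indicator hs)).comp lam.measurable_meas
  let κ : Kernel (UnitSpace X) X := ⟨fun u => (lam.meas u).withDensity b, hm⟩
  have hκ : IsMarkovKernel κ := ⟨fun u => ⟨by
    change (lam.meas u).withDensity b univ = 1
    rw [withDensity_apply _ MeasurableSet.univ, Measure.restrict_univ, hb1]⟩⟩
  have hu : Measurable (Function.uncurry fun (_ : UnitSpace X) (x : X) => (b x)⁻¹) :=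
    hb.inv.comp measurable_snd
  have h : lam.kernel = Kernel.withDensity κ fun _ x => (b x)⁻¹ := by
    ext1 u
    rw [Kernel.withDensity_apply κ hu]
    change lam.meas u = ((lam.meas u).withDensity b).withDensity fun x => (b x)⁻¹
    exact (withDensity_inv_same hb (Eventually.of_forall hb0) (Eventually.of_forall hbt)).symm
  rw [h]
  exact Kernel.IsSFiniteKernel.withDensity κ fun _ x => ENNReal.inv_ne_top.2 (hb0 x)

instance [OpenTopGroupoid X] (u : UnitSpace X) : SFinite (lam.meas u) :=
  inferInstanceAs (SFinite (lam.kernel u))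

/-- Integration against a Haar system preserves joint measurability. -/
theorem measurable_lintegral [OpenTopGroupoid X] {A : Type*} [MeasurableSpace A]
    {u : A → UnitSpace X} (hu : Measurable u) {f : A → X → ℝ≥0∞}
    (hf : Measurable fun p : A × X => f p.1 p.2) :
    Measurable fun a => ∫⁻ x, f a x ∂lam.meas (u a) :=
  Measurable.lintegral_kernel_prod_right' (κ := lam.kernel.comap u hu) hf

end HaarSystem

/-! ### Uniqueness of a measure linked to its partner by a homomorphism -/

/-- A Borel homomorphism from a groupoid into the multiplicative group `(0, ∞)`, viewed inside
`[0, ∞]`. -/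
structure IsBorelHom {X : Type*} [MeasurableSpace X] [ArrowGroupoid X] (D : X → ℝ≥0∞) : Prop where
  measurable : Measurable D
  ne_zero : ∀ x, D x ≠ 0
  ne_top : ∀ x, D x ≠ ∞
  map_mulT : ∀ x y, src x = rng y → D (mulT x y) = D x * D y

namespace IsBorelHom

variable {X : Type*} [MeasurableSpace X] [ArrowGroupoid X] {D : X → ℝ≥0∞}

theorem map_src (hD : IsBorelHom D) (x : X) : D (src x) = 1 := by
  have h := hD.map_mulT x (src x) (rng_src x).symm
  rw [mulT_src_self] at h
  exact ((ENNReal.mul_right_inj (hD.ne_zero x) (hD.ne_top x)).1 ((mul_one _).trans h)).symm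

theorem mul_inv (hD : IsBorelHom D) (x : X) : D x * D (inv x) = 1 := by
  rw [← hD.map_mulT x (inv x) (rng_inv x).symm, mulT_inv_self, ← src_inv, hD.map_src]

end IsBorelHom

namespace HaarSystem

variable {X : Type*} [TopologicalSpace X] [LocallyCompactSpace X] [T2Space X]
  [SecondCountableTopology X] [MeasurableSpace X] [BorelSpace X] [ArrowGroupoid X]
  [OpenTopGroupoid X] (lam : HaarSystem X)

/-- `D` intertwines `μ` and `μ'`: the measure `∫ λᵘ dμ(u)` is `D` times the image of
`∫ λᵘ dμ'(u)` under inversion. For `μ' = μ` this is the defining property of a modular function. -/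
def Intertwines (D : X → ℝ≥0∞) (μ μ' : Measure (UnitSpace X)) : Prop :=
  ∀ f : X → ℝ≥0∞, Measurable f →
    ∫⁻ u, ∫⁻ x, f x ∂lam.meas u ∂μ = ∫⁻ u, ∫⁻ x, f (inv x) * D (inv x) ∂lam.meas u ∂μ'

variable {lam} {D : X → ℝ≥0∞} {μ μ' : Measure (UnitSpace X)}

theorem Intertwines.symm (hD : IsBorelHom D) (h : lam.Intertwines D μ μ') :
    lam.Intertwines D μ' μ := by
  intro f hf
  rw [h (fun x => f (inv x) * D (inv x))
    ((hf.comp measurable_arrowInv).mul (hD.measurable.comp measurable_arrowInv))]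
  simp_rw [inv_inv_eq, mul_assoc, hD.mul_inv, mul_one]

variable (lam) in
/-- The integral over pairs of arrows with a common range distributed as `μ`. -/
noncomputable def pairIntegral (μ : Measure (UnitSpace X)) (g : X → X → ℝ≥0∞) : ℝ≥0∞ :=
  ∫⁻ u, ∫⁻ x, ∫⁻ y, g x y ∂lam.meas u ∂lam.meas u ∂μ

theorem pairIntegral_congr {g g' : X → X → ℝ≥0∞} (h : ∀ x y, rng x = rng y → g x y = g' x y) :
    lam.pairIntegral μ g = lam.pairIntegral μ g' := by
  refine lintegral_congr fun u => lintegral_congr_ae ?_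
  filter_upwards [lam.ae_rngUnit u] with x hx
  refine lintegral_congr_ae ?_
  filter_upwards [lam.ae_rngUnit u] with y hy
  exact h x y (congrArg Subtype.val (hx.trans hy.symm))

theorem pairIntegral_swap {g : X → X → ℝ≥0∞} (hg : Measurable fun p : X × X => g p.1 p.2) :
    lam.pairIntegral μ (fun x y => g y x) = lam.pairIntegral μ g :=
  lintegral_congr fun _ => lintegral_lintegral_swap (hg.comp measurable_swap).aemeasurable

/-- If `D` intertwines `μ` and `μ'`, then the move `(x, y) ↦ (x⁻¹, x⁻¹y)` on pairs takes the
integral for `μ` into the integral for `μ'`. -/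
theorem Intertwines.pairIntegral_eq (h : lam.Intertwines D μ μ')
    {g : X → X → ℝ≥0∞} (hg : Measurable fun p : X × X => g p.1 p.2) :
    lam.pairIntegral μ g =
      lam.pairIntegral μ' fun x y => g (inv x) (mulT (inv x) y) * D (inv x) := by
  have hgm : Measurable fun p : X × X => g p.1 (mulT p.1 p.2) :=
    hg.comp (measurable_fst.prodMk measurable_mulT)
  have h1 : lam.pairIntegral μ g =
      ∫⁻ u, ∫⁻ x, (∫⁻ y, g x (mulT x y) ∂lam.meas (srcUnit x)) ∂lam.meas u ∂μ := by
    refine lintegral_congr fun u => lintegral_congr_ae ?_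
    filter_upwards [lam.ae_rngUnit u] with x hx
    rw [lam.lintegral_mulT x (f := fun y => g x y) (hg.comp (measurable_const.prodMk measurable_id)),
      hx]
  rw [h1, h _ (lam.measurable_lintegral measurable_srcUnit hgm)]
  refine lintegral_congr fun u => lintegral_congr_ae ?_
  filter_upwards [lam.ae_rngUnit u] with x hx
  rw [srcUnit_inv, hx, lintegral_mul_const]
  exact hgm.comp (measurable_const.prodMk measurable_id)

/-- Intertwined measures coincide. A pair of arrows `(x, y)` with a common range is a triangle with
sides `x`, `y`, `x⁻¹y`, and the symmetric group of its vertices acts on such pairs. One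
transposition `S` swaps `x` and `y`; it preserves each pair integral. Another transposition `A` is
the move of `Intertwines.pairIntegral_eq`; it exchanges the two pair integrals. In the braid
relation `A S A = S A S` one side has an even and the other an odd number of factors `A`. -/
theorem Intertwines.eq (hD : IsBorelHom D) (h : lam.Intertwines D μ μ') : μ = μ' := by
  have hpair : ∀ g : X → X → ℝ≥0∞, Measurable (fun p : X × X => g p.1 p.2) →
      lam.pairIntegral μ g = lam.pairIntegral μ' g := by
    intro g hg
    let A : (X → X → ℝ≥0∞) → X → X → ℝ≥0∞ :=
      fun g x y => g (inv x) (mulT (inv x) y) * D (inv x)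
    let S : (X → X → ℝ≥0∞) → X → X → ℝ≥0∞ := fun g x y => g y x
    have hA : ∀ {g : X → X → ℝ≥0∞}, Measurable (fun p : X × X => g p.1 p.2) →
        Measurable fun p : X × X => A g p.1 p.2 := by
      intro g hg
      have hi : Measurable fun p : X × X => inv p.1 := measurable_arrowInv.comp measurable_fst
      exact (hg.comp (hi.prodMk (measurable_mulT.comp (hi.prodMk measurable_snd)))).mul
        (hD.measurable.comp hi)
    have hS : ∀ {g : X → X → ℝ≥0∞}, Measurable (fun p : X × X => g p.1 p.2) →
        Measurable fun p : X × X => S g p.1 p.2 := fun hg => hg.comp measurable_swap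
    have braid : ∀ x y, rng x = rng y → A (S (A g)) x y = S (A (S g)) x y := by
      intro x y hxy
      have e : src (inv y) = rng x := by rw [src_inv, hxy]
      have e' : src (inv x) = rng y := by rw [src_inv, hxy]
      have h1 : inv (mulT (inv x) y) = mulT (inv y) x := by rw [inv_mulT e', inv_inv_eq]
      have h2 : mulT (mulT (inv y) x) (inv x) = inv y := mulT_mulT_inv e
      have h3 : src (mulT (inv y) x) = rng (inv x) := by rw [mulT_of e, src_mul, rng_inv]
      simp only [A, S, h1, h2]
      rw [mul_assoc, ← hD.map_mulT _ _ h3, h2]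
    calc lam.pairIntegral μ g = lam.pairIntegral μ' (A g) := h.pairIntegral_eq hg
      _ = lam.pairIntegral μ' (S (A g)) := (pairIntegral_swap (hA hg)).symm
      _ = lam.pairIntegral μ (A (S (A g))) := (h.symm hD).pairIntegral_eq (hS (hA hg))
      _ = lam.pairIntegral μ (S (A (S g))) := pairIntegral_congr braid
      _ = lam.pairIntegral μ (A (S g)) := pairIntegral_swap (hA (hS hg))
      _ = lam.pairIntegral μ' (S g) := ((h.symm hD).pairIntegral_eq (hS hg)).symm
      _ = lam.pairIntegral μ' g := pairIntegral_swap hg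
  obtain ⟨b, hb, -, -, hb1⟩ := lam.exists_weight
  -- Weighting both arrows by `b` recovers `μ` from its pair integral.
  refine Measure.ext fun s hs => ?_
  have hφ : Measurable (s.indicator (1 : UnitSpace X → ℝ≥0∞)) := measurable_one.indicator hs
  have key : ∀ m : Measure (UnitSpace X),
      lam.pairIntegral m (fun x y => s.indicator 1 (rngUnit x) * b x * b y) = m s := by
    intro m
    rw [← lintegral_indicator_one hs]
    refine lintegral_congr fun u => ?_
    calc _ = ∫⁻ x, s.indicator 1 u * b x ∂lam.meas u := by
          refine lintegral_congr_ae ?_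
          filter_upwards [lam.ae_rngUnit u] with x hx
          rw [lintegral_const_mul _ hb, hb1, mul_one, hx]
      _ = s.indicator 1 u := by rw [lintegral_const_mul _ hb, hb1, mul_one]
  rw [← key μ, ← key μ']
  exact hpair _ (((hφ.comp (measurable_rngUnit.comp measurable_fst)).mul
    (hb.comp measurable_fst)).mul (hb.comp measurable_snd))

end HaarSystem

/-! ### The action as a Borel map -/

namespace IsoAction

variable {G H : Type*} [TopologicalSpace G] [ArrowGroupoid G]
    [TopologicalSpace H] [ArrowGroupoid H] (α : IsoAction G H)

open Classical in
/-- The action as a function on all pairs, with value `h` at a pair `(x, h)` outside its domain. -/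
noncomputable def actT (x : G) (h : H) : H :=
  if e : src x = (α.moment h).1 then α.act x h e else h

theorem actT_of {x : G} {h : H} (e : src x = (α.moment h).1) : α.actT x h = α.act x h e :=
  dif_pos e

/-- The moment map on units. -/
def mom (v : UnitSpace H) : UnitSpace G := α.moment v.1

/-- The action on units as a function on all pairs. -/
noncomputable def actUnitT (x : G) (v : UnitSpace H) : UnitSpace H := rngUnit (α.actT x v.1)

theorem actUnitT_of {x : G} {v : UnitSpace H} (e : src x = (α.moment v.1).1) :
    α.actUnitT x v = α.actUnit x v e := by
  refine Subtype.ext ?_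
  change rng (α.actT x v.1) = α.act x v.1 e
  rw [α.actT_of e, α.rng_act_unit x v.1 v.2 e]

theorem mom_rngUnit (h : H) : α.mom (rngUnit h) = α.moment h := α.moment_rng h

theorem mom_srcUnit (h : H) : α.mom (srcUnit h) = α.moment h := α.moment_src h

variable [MeasurableSpace G] [BorelSpace G] [MeasurableSpace H] [BorelSpace H]
  [T2Space G] [SecondCountableTopology G] [OpenTopGroupoid G]
  [T2Space H] [SecondCountableTopology H] [OpenTopGroupoid H]

theorem measurable_mom : Measurable α.mom :=
  α.continuous_moment.measurable.comp measurable_subtype_coe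

theorem measurable_actT : Measurable fun p : G × H => α.actT p.1 p.2 := by
  classical
  exact measurable_dite_of_isClosed (p := fun p : G × H => src p.1 = (α.moment p.2).1)
    (isClosed_eq (OpenTopGroupoid.continuous_src.comp continuous_fst)
      (continuous_subtype_val.comp (α.continuous_moment.comp continuous_snd)))
    α.continuous_act.measurable measurable_snd

theorem measurable_actUnitT : Measurable fun p : G × UnitSpace H => α.actUnitT p.1 p.2 :=
  measurable_rngUnit.comp (α.measurable_actT.comp
    (measurable_fst.prodMk (measurable_subtype_coe.comp measurable_snd)))

variable [LocallyCompactSpace G] [LocallyCompactSpace H]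

theorem ae_moment (lamH : HaarSystem H) (v : UnitSpace H) :
    ∀ᵐ h ∂lamH.meas v, α.moment h = α.mom v := by
  filter_upwards [lamH.ae_rngUnit v] with h hh
  rw [← hh, α.mom_rngUnit]

/-- Invariance of the Haar system of `H`, for all nonnegative Borel functions. -/
theorem Invariant.lintegral_actT {α : IsoAction G H} {lamH : HaarSystem H} (hinv : α.Invariant lamH)
    {x : G} {v : UnitSpace H} (e : src x = (α.moment v.1).1) {f : H → ℝ≥0∞} (hf : Measurable f) :
    ∫⁻ h, f (α.actT x h) ∂lamH.meas v = ∫⁻ h, f h ∂lamH.meas (α.actUnitT x v) := by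
  have hc : ∀ z : G, Continuous fun h : {h : H // src z = (α.moment h).1} => α.act z h.1 h.2 :=
    fun z => α.continuous_act.comp
      (Continuous.subtype_mk (continuous_const.prodMk continuous_subtype_val) fun h => h.2)
  have hcl : ∀ z : G, IsClosed {h : H | src z = (α.moment h).1} := fun z =>
    isClosed_eq continuous_const (continuous_subtype_val.comp α.continuous_moment)
  have hm : Measurable (α.actT x) :=
    α.measurable_actT.comp (measurable_const.prodMk measurable_id)
  have ht : ∀ h : {h : H // src x = (α.moment h).1},
      src (inv x) = (α.moment (α.act x h.1 h.2)).1 := fun h => by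
    rw [α.moment_act, src_inv]; rfl
  have key := map_eq_of_integral_subtype_eq (κ₁ := lamH.meas v)
    (κ₂ := lamH.meas (α.actUnit x v e)) (hcl x) (hcl (inv x))
    ((α.ae_moment lamH v).mono fun h hh => e.trans (congrArg Subtype.val hh).symm)
    (hc (inv x)) ht
    (fun h => (α.act_act (inv x) x h.1 (src_inv x) h.2).trans
      (α.act_of_unit (by rw [rng_mul, inv_mul_eq, rng_inv]) _))
    hm (fun h => α.actT_of h.2) (fun f => hinv f x v e)
  rw [α.actUnitT_of e, ← key, lintegral_map hf hm]

/-! ### Integration over the semidirect product and over its subgroupoid -/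

theorem _root_.lintegral_inducedMeasure_map {K A : Type*} [MeasurableSpace K] [ArrowGroupoid K]
    [MeasurableSpace A] {κ : UnitSpace K → Measure K} (hκ : Measurable κ) {ι : A → UnitSpace K}
    (hι : Measurable ι) (μ : Measure A) {f : K → ℝ≥0∞} (hf : Measurable f) :
    ∫⁻ p, f p ∂inducedMeasure κ (μ.map ι) = ∫⁻ a, ∫⁻ p, f p ∂κ (ι a) ∂μ :=
  (Measure.lintegral_bind hκ.aemeasurable hf.aemeasurable).trans
    (lintegral_map ((Measure.measurable_lintegral hf).comp hκ) hι)

variable (lamG : HaarSystem G) (lamH : HaarSystem H) (μ : Measure (UnitSpace H))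

theorem lintegral_sdHaar {F : H → G → ℝ≥0∞} (hF : Measurable fun p : H × G => F p.1 p.2) :
    ∫⁻ p, F (fst p) (snd p) ∂inducedMeasure (α.sdHaar lamG lamH) (μ.map α.sdUnit) =
      ∫⁻ v, ∫⁻ h, ∫⁻ x, F h x ∂lamG.meas (α.mom v) ∂lamH.meas v ∂μ := by
  have hι := α.measurableEmbedding_sd
  have hFι : Measurable fun p : α.SemidirectProduct => F (fst p) (snd p) := hF.comp hι.measurable
  rw [lintegral_inducedMeasure_map (α.measurable_sdHaar lamG lamH) α.measurable_sdUnit μ hFι]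
  refine lintegral_congr fun v => ?_
  have hw : sdUnitFst (α.sdUnit v) = v := rfl
  have hu : sdUnitSnd (α.sdUnit v) = α.mom v := rfl
  rw [sdHaar, hw, hu, ← hι.lintegral_map (f := fun q : H × G => F q.1 q.2), hι.map_comap,
    Measure.restrict_eq_self_of_ae_mem, lintegral_prod _ hF.aemeasurable]
  have hm : MeasurableSet (range fun p : α.SemidirectProduct => (fst p, snd p)) :=
    hι.measurableSet_range
  refine (Measure.ae_prod_mem_iff_ae_ae_mem hm).2 ?_
  filter_upwards [α.ae_moment lamH v] with h hh
  filter_upwards [lamG.ae_rngUnit (α.mom v)] with x hx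
  exact ⟨sdMk h x (congrArg Subtype.val (hh.trans hx.symm)), rfl⟩

theorem lintegral_rhoHaar {F : UnitSpace H → G → ℝ≥0∞}
    (hF : Measurable fun p : UnitSpace H × G => F p.1 p.2) :
    ∫⁻ p, F (rngUnit (fst (rhoIncl p))) (snd (rhoIncl p))
        ∂inducedMeasure (α.rhoHaar lamG) (μ.map α.rhoUnit) =
      ∫⁻ v, ∫⁻ x, F v x ∂lamG.meas (α.mom v) ∂μ := by
  have hι := α.measurableEmbedding_rho
  have hFr : Measurable fun q : H × G => F (rngUnit q.1) q.2 :=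
    hF.comp ((measurable_rngUnit.comp measurable_fst).prodMk measurable_snd)
  have hFι : Measurable fun p : α.RhoGroupoid => F (rngUnit (fst (rhoIncl p))) (snd (rhoIncl p)) :=
    hFr.comp hι.measurable
  rw [lintegral_inducedMeasure_map (α.measurable_rhoHaar lamG) α.measurable_rhoUnit μ hFι]
  refine lintegral_congr fun v => ?_
  have hw : sdUnitFst (rhoUnitIncl (α.rhoUnit v)) = v := rfl
  have hu : sdUnitSnd (rhoUnitIncl (α.rhoUnit v)) = α.mom v := rfl
  rw [rhoHaar, hw, hu, ← hι.lintegral_map (f := fun q : H × G => F (rngUnit q.1) q.2),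
    hι.map_comap, Measure.restrict_eq_self_of_ae_mem, lintegral_prod _ hFr.aemeasurable,
    lintegral_dirac]
  · simp only [rngUnit_unit]
  have hm : MeasurableSet
      (range fun p : α.RhoGroupoid => (fst (rhoIncl p), snd (rhoIncl p))) :=
    hι.measurableSet_range
  refine (Measure.ae_prod_mem_iff_ae_ae_mem hm).2 ?_
  rw [ae_dirac_eq, eventually_pure]
  filter_upwards [lamG.ae_rngUnit (α.mom v)] with x hx
  exact ⟨rhoMk v x (congrArg Subtype.val hx.symm), rfl⟩

/-! ### Splitting the modular function -/

/-- The relation between `μ`, a homomorphism `D` on `H` and a function `d` on `G_ρ` which says that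
`(h, x) ↦ D(h) d(s(h), x)` is the density of `ν` with respect to `ν⁻¹` on `H ⋊ G`, after the
substitution `h = x · k` in the integral over the inverses `(x⁻¹ · h⁻¹, x⁻¹) = (k⁻¹, x⁻¹)`. -/
def SplitDensity (D : H → ℝ≥0∞) (d : UnitSpace H → G → ℝ≥0∞) : Prop :=
  ∀ F : H → G → ℝ≥0∞, (Measurable fun p : H × G => F p.1 p.2) →
    ∫⁻ v, ∫⁻ h, ∫⁻ x, F h x ∂lamG.meas (α.mom v) ∂lamH.meas v ∂μ =
      ∫⁻ v, ∫⁻ x, d (α.actUnitT (inv x) v) (inv x) *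
        ∫⁻ k, F (inv k) (inv x) * D (inv k) ∂lamH.meas (α.actUnitT (inv x) v)
          ∂lamG.meas (α.mom v) ∂μ

/-- `d` is the density on `G_ρ` of `∫ σᵛ dμ'(v)` with respect to the image of `∫ σᵛ dμ(v)`
under inversion. -/
def RhoIntertwines (d : UnitSpace H → G → ℝ≥0∞) (μ' : Measure (UnitSpace H)) : Prop :=
  ∀ φ : UnitSpace H → G → ℝ≥0∞, (Measurable fun p : UnitSpace H × G => φ p.1 p.2) →
    ∫⁻ w, ∫⁻ y, φ w y ∂lamG.meas (α.mom w) ∂μ' =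
      ∫⁻ v, ∫⁻ x, d (α.actUnitT (inv x) v) (inv x) * φ (α.actUnitT (inv x) v) (inv x)
        ∂lamG.meas (α.mom v) ∂μ

variable {α lamG lamH μ} {D : H → ℝ≥0∞} {d : UnitSpace H → G → ℝ≥0∞}

/-- A partner `μ'` of `μ` on `G_ρ` is the image under `s` of `∫ λᵛ dμ(v)` with a weight chosen such
that the integral over `H` on the other side of `SplitDensity` becomes `1`. -/
theorem SplitDensity.exists_rhoIntertwines (hD : IsBorelHom D)
    (h : α.SplitDensity lamG lamH μ D d) : ∃ μ', α.RhoIntertwines lamG μ d μ' := by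
  obtain ⟨b, hb, -, -, hb1⟩ := lamH.exists_weight
  -- The factor `D (inv h)` cancels the factor `D (inv k)` in `SplitDensity`, and `∫ b dλᵛ = 1`.
  let w : H → ℝ≥0∞ := fun h => b (inv h) * D (inv h)
  have hw : Measurable w := (hb.comp measurable_arrowInv).mul (hD.measurable.comp measurable_arrowInv)
  refine ⟨((μ.bind lamH.meas).withDensity w).map srcUnit, fun φ hφ => ?_⟩
  have hψ : Measurable fun u => ∫⁻ y, φ u y ∂lamG.meas (α.mom u) :=
    lamG.measurable_lintegral α.measurable_mom hφ
  have hψs := hψ.comp (measurable_srcUnit (X := H))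
  rw [lintegral_map hψ measurable_srcUnit]
  refine (lintegral_withDensity_eq_lintegral_mul _ hw hψs).trans ?_
  rw [Measure.lintegral_bind lamH.measurable_meas.aemeasurable (hw.mul hψs).aemeasurable]
  have hφs : Measurable fun p : H × G => φ (srcUnit p.1) p.2 :=
    hφ.comp ((measurable_srcUnit.comp measurable_fst).prodMk measurable_snd)
  calc _ = ∫⁻ v, ∫⁻ h, ∫⁻ x, w h * φ (srcUnit h) x ∂lamG.meas (α.mom v) ∂lamH.meas v ∂μ := by
        refine lintegral_congr fun v => lintegral_congr_ae ?_
        filter_upwards [α.ae_moment lamH v] with h hh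
        have hφh : Measurable (φ (srcUnit h)) := hφs.comp (measurable_const.prodMk measurable_id)
        rw [lintegral_const_mul _ hφh, ← hh, ← α.mom_srcUnit]
        rfl
    _ = _ := by
        rw [h (fun h x => w h * φ (srcUnit h) x) ((hw.comp measurable_fst).mul hφs)]
        refine lintegral_congr fun v => lintegral_congr fun x => ?_
        congr 1
        rw [← mul_one (φ _ _), ← hb1 (α.actUnitT (inv x) v), ← lintegral_const_mul _ hb]
        refine lintegral_congr_ae ?_
        filter_upwards [lamH.ae_rngUnit (α.actUnitT (inv x) v)] with k hk
        have hDk : D (inv k) * D k = 1 := by rw [mul_comm, hD.mul_inv]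
        simp only [w, inv_inv_eq, srcUnit_inv, hk]
        rw [mul_assoc, mul_assoc, mul_left_comm (D k), mul_comm (D k), hDk, mul_one, mul_comm]

/-- A partner of `μ` on `G_ρ` is also a partner of `μ` on `H`: apply `SplitDensity` to
`f(h) c(x)` with `∫ c dλᵘ = 1`, and rewrite the right side, an integral over `G_ρ`, in terms
of `μ'`. -/
theorem SplitDensity.intertwines (hD : IsBorelHom D) (h : α.SplitDensity lamG lamH μ D d)
    {μ' : Measure (UnitSpace H)} (h' : α.RhoIntertwines lamG μ d μ') :
    lamH.Intertwines D μ μ' := by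
  obtain ⟨c, hc, -, -, hc1⟩ := lamG.exists_weight
  intro f hf
  have hg : Measurable fun k => f (inv k) * D (inv k) :=
    (hf.comp measurable_arrowInv).mul (hD.measurable.comp measurable_arrowInv)
  have hI : Measurable fun v => ∫⁻ k, f (inv k) * D (inv k) ∂lamH.meas v :=
    (Measure.measurable_lintegral hg).comp lamH.measurable_meas
  calc ∫⁻ v, ∫⁻ h, f h ∂lamH.meas v ∂μ
      = ∫⁻ v, ∫⁻ h, ∫⁻ x, f h * c x ∂lamG.meas (α.mom v) ∂lamH.meas v ∂μ := by
        simp_rw [lintegral_const_mul _ hc, hc1, mul_one]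
    _ = ∫⁻ v, ∫⁻ x, d (α.actUnitT (inv x) v) (inv x) *
          ((∫⁻ k, f (inv k) * D (inv k) ∂lamH.meas (α.actUnitT (inv x) v)) * c (inv x))
          ∂lamG.meas (α.mom v) ∂μ := by
        rw [h (fun h x => f h * c x) ((hf.comp measurable_fst).mul (hc.comp measurable_snd))]
        simp_rw [mul_right_comm _ (c _), lintegral_mul_const _ hg]
    _ = ∫⁻ w, ∫⁻ y, (∫⁻ k, f (inv k) * D (inv k) ∂lamH.meas w) * c y
          ∂lamG.meas (α.mom w) ∂μ' :=
        (h' (fun w y => (∫⁻ k, f (inv k) * D (inv k) ∂lamH.meas w) * c y)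
          ((hI.comp measurable_fst).mul (hc.comp measurable_snd))).symm
    _ = ∫⁻ w, ∫⁻ k, f (inv k) * D (inv k) ∂lamH.meas w ∂μ' := by
        simp_rw [lintegral_const_mul _ hc, hc1, mul_one]

/-- The partner of `μ` is `μ` itself, so that both factors of the density are modular. -/
theorem SplitDensity.modular (hD : IsBorelHom D) (h : α.SplitDensity lamG lamH μ D d) :
    lamH.Intertwines D μ μ ∧ α.RhoIntertwines lamG μ d μ := by
  obtain ⟨μ', h'⟩ := h.exists_rhoIntertwines hD
  have hH := h.intertwines hD h'
  obtain rfl := hH.eq hD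
  exact ⟨hH, h'⟩

end IsoAction

/-! ### Modular functions through integrals -/

section Modular

variable {K : Type*} [MeasurableSpace K] [ArrowGroupoid K] {κ : UnitSpace K → Measure K}
  {μ : Measure (UnitSpace K)} {Δ : K → ℝ}

theorem IsModularFunction.lintegral_eq (hΔ : IsModularFunction κ μ Δ)
    (hi : Measurable (inv : K → K)) {f : K → ℝ≥0∞} (hf : Measurable f) :
    ∫⁻ x, f x ∂inducedMeasure κ μ =
      ∫⁻ x, f (inv x) * ENNReal.ofReal (Δ (inv x)) ∂inducedMeasure κ μ := by
  have hΔm := hΔ.measurable.ennreal_ofReal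
  conv_lhs => rw [hΔ.density]
  rw [lintegral_withDensity_eq_lintegral_mul _ hΔm hf, lintegral_map (hΔm.mul hf) hi]
  simp only [Pi.mul_apply, mul_comm]

/-- A positive density makes `ν` and `ν⁻¹` equivalent. -/
theorem IsModularFunction.quasiInvariant (hΔ : IsModularFunction κ μ Δ) : QuasiInvariant κ μ := by
  have hΔm := hΔ.measurable.ennreal_ofReal
  rw [QuasiInvariant]
  generalize hm : (inducedMeasure κ μ).map inv = m
  rw [hΔ.density, hm]
  exact ⟨withDensity_absolutelyContinuous _ _, withDensity_absolutelyContinuous' hΔm.aemeasurable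
    (Eventually.of_forall fun x => (ENNReal.ofReal_pos.2 (hΔ.pos x)).ne')⟩

theorem inducedMeasure_eq_withDensity (hi : Measurable (inv : K → K)) (hΔ : Measurable Δ)
    (h : ∀ f : K → ℝ≥0∞, Measurable f → ∫⁻ x, f x ∂inducedMeasure κ μ =
      ∫⁻ x, f (inv x) * ENNReal.ofReal (Δ (inv x)) ∂inducedMeasure κ μ) :
    inducedMeasure κ μ =
      ((inducedMeasure κ μ).map inv).withDensity fun x => ENNReal.ofReal (Δ x) := by
  refine Measure.ext_of_lintegral _ fun f hf => ?_
  rw [lintegral_withDensity_eq_lintegral_mul _ hΔ.ennreal_ofReal hf,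
    lintegral_map (hΔ.ennreal_ofReal.mul hf) hi, h f hf]
  simp only [Pi.mul_apply, mul_comm]

end Modular

/-! ### Restricting a modular function of the semidirect product to its two subgroupoids -/

namespace IsoAction

variable {G H : Type*} [TopologicalSpace G] [ArrowGroupoid G]
    [TopologicalSpace H] [ArrowGroupoid H] (α : IsoAction G H)

/-- The embedding `h ↦ (h, ρ(h))` of `H` into the semidirect product. -/
def ofH (h : H) : α.SemidirectProduct := sdMk h (α.moment h).1 (α.moment h).2.symm

theorem src_ofH (h : H) : src (α.ofH h) = α.ofH (src h) := by
  refine sd_ext ?_ ?_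
  · refine (α.act_congr (inv_of_unit (α.moment h).2) rfl _ ?_).trans
      (α.act_of_unit (α.moment h).2 ?_)
    all_goals
      exact (src_of_unit (α.moment h).2).trans (congrArg Subtype.val (α.moment_src h)).symm
  · exact (src_of_unit (α.moment h).2).trans (congrArg Subtype.val (α.moment_src h)).symm

theorem rng_ofH (h : H) : rng (α.ofH h) = α.ofH (rng h) :=
  sd_ext rfl ((α.moment h).2.trans (congrArg Subtype.val (α.moment_rng h)).symm)

theorem mul_ofH {h k : H} (e : src h = rng k) :
    ∃ e', mul (α.ofH h) (α.ofH k) e' = α.ofH (mul h k e) := by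
  have e' : src (α.ofH h) = rng (α.ofH k) := by rw [src_ofH, rng_ofH, e]
  have hm : α.moment h = α.moment k := by rw [← α.moment_src, e, α.moment_rng]
  refine ⟨e', sd_ext ?_ ?_⟩
  · exact mul_congr_arrow rfl (α.act_of_unit (α.moment h).2 _) _ e
  · refine (mul_unit _ (α.moment k).2).trans ?_
    exact (congrArg Subtype.val (α.moment_mul h k e hm)).symm

/-- Every element factors as `(h, x) = (h, ρ(h)) (s(h), x)`. -/
theorem exists_mul_ofH_rhoMk (h : H) (x : G) (e : (α.moment h).1 = rng x) :
    ∃ e', mul (α.ofH h) (rhoIncl (rhoMk (srcUnit h) x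
      ((congrArg Subtype.val (α.moment_src h)).trans e))) e' = sdMk h x e := by
  have e' : src (α.ofH h) = rng (rhoIncl (rhoMk (srcUnit h) x
      ((congrArg Subtype.val (α.moment_src h)).trans e))) := by
    rw [src_ofH]
    exact sd_ext (rng_src h).symm ((congrArg Subtype.val (α.moment_src h)).trans e)
  refine ⟨e', sd_ext ?_ (unit_mul _ (α.moment h).2)⟩
  exact (mul_congr_arrow rfl (α.act_of_unit (α.moment h).2 _) _ (rng_src h).symm).trans
    (mul_src_self h)

variable {α}

open Classical in
/-- A function on `G_ρ` as a function on `H⁽⁰⁾ × G`, extended by zero. -/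
noncomputable def rhoExt (f : α.RhoGroupoid → ℝ≥0∞) (v : UnitSpace H) (x : G) : ℝ≥0∞ :=
  if e : (α.moment v.1).1 = rng x then f (rhoMk v x e) else 0

theorem rhoExt_rhoMk (f : α.RhoGroupoid → ℝ≥0∞) {v : UnitSpace H} {x : G}
    (e : (α.moment v.1).1 = rng x) : rhoExt f v x = f (rhoMk v x e) := dif_pos e

theorem rhoExt_apply (f : α.RhoGroupoid → ℝ≥0∞) (p : α.RhoGroupoid) :
    rhoExt f (rngUnit (fst (rhoIncl p))) (snd (rhoIncl p)) = f p := by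
  have hv : rng (fst (rhoIncl p)) = fst (rhoIncl p) := p.2
  have e : (α.moment (rng (fst (rhoIncl p)))).1 = rng (snd (rhoIncl p)) := by
    rw [hv, moment_fst]
  rw [rhoExt_rhoMk f e]
  exact congrArg f (rho_ext (sd_ext hv rfl))

theorem rngUnit_fst_inv (p : α.RhoGroupoid) : rngUnit (fst (rhoIncl (inv p))) =
    α.actUnitT (inv (snd (rhoIncl p))) (rngUnit (fst (rhoIncl p))) := by
  have hv : rng (fst (rhoIncl p)) = fst (rhoIncl p) := p.2
  refine congrArg rngUnit (Eq.trans ?_ (α.actT_of (src_inv_snd _ (α.moment_rng _))).symm)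
  exact α.act_congr rfl ((inv_of_unit hv).trans hv.symm) _ _

theorem fst_inv_eq (p : α.SemidirectProduct) :
    fst (inv p) = α.actT (inv (snd p)) (inv (fst p)) :=
  (α.actT_of (src_inv_snd p (α.moment_inv _))).symm

variable [MeasurableSpace G] [BorelSpace G] [MeasurableSpace H] [BorelSpace H]
  [T2Space G] [SecondCountableTopology G] [OpenTopGroupoid G]
  [T2Space H] [SecondCountableTopology H] [OpenTopGroupoid H]

theorem measurable_rhoExt {f : α.RhoGroupoid → ℝ≥0∞} (hf : Measurable f) :
    Measurable fun p : UnitSpace H × G => rhoExt f p.1 p.2 := by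
  classical
  refine measurable_dite_of_isClosed (p := fun p : UnitSpace H × G => (α.moment p.1.1).1 = rng p.2)
    (isClosed_eq (continuous_subtype_val.comp
      (α.continuous_moment.comp (continuous_subtype_val.comp continuous_fst)))
      (OpenTopGroupoid.continuous_rng.comp continuous_snd)) (g := fun p => f (rhoMk p.1.1 p.1.2 p.2))
    (hf.comp ?_) measurable_const
  have h1 : Measurable fun p : {p : UnitSpace H × G // (α.moment p.1.1).1 = rng p.2} =>
      (p.1.1.1, p.1.2) :=
    (measurable_subtype_coe.comp (measurable_fst.comp measurable_subtype_coe)).prodMk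
      (measurable_snd.comp measurable_subtype_coe)
  exact (h1.subtype_mk (h := fun p => p.2)).subtype_mk (h := fun p => p.1.1.2)

theorem measurable_ofH : Measurable α.ofH := by
  have h : Measurable fun h : H => (α.moment h).1 :=
    measurable_subtype_coe.comp α.continuous_moment.measurable
  exact (measurable_id.prodMk h).subtype_mk

variable [LocallyCompactSpace G] [LocallyCompactSpace H]
  {lamG : HaarSystem G} {lamH : HaarSystem H} {μ : Measure (UnitSpace H)}
  {Δ : α.SemidirectProduct → ℝ}

theorem isBorelHom_ofH (hΔ : IsModularFunction (α.sdHaar lamG lamH) (μ.map α.sdUnit) Δ) :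
    IsBorelHom fun h => ENNReal.ofReal (Δ (α.ofH h)) where
  measurable := (hΔ.measurable.comp measurable_ofH).ennreal_ofReal
  ne_zero h := (ENNReal.ofReal_pos.2 (hΔ.pos _)).ne'
  ne_top h := ENNReal.ofReal_ne_top
  map_mulT h k e := by
    obtain ⟨e', he⟩ := α.mul_ofH e
    rw [mulT_of e, ← he, hΔ.map_mul, ENNReal.ofReal_mul (hΔ.pos _).le]

/-- The density of `ν` splits along `(h, x) = (h, ρ(h)) (s(h), x)`; invariance of the Haar system of
`H` justifies the substitution `h = x · k`. -/
theorem splitDensity (hinv : α.Invariant lamH)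
    (hΔ : IsModularFunction (α.sdHaar lamG lamH) (μ.map α.sdUnit) Δ) :
    α.SplitDensity lamG lamH μ (fun h => ENNReal.ofReal (Δ (α.ofH h)))
      (rhoExt fun p => ENNReal.ofReal (Δ (rhoIncl p))) := by
  have hD := isBorelHom_ofH hΔ
  have hΔι : Measurable fun p : α.RhoGroupoid => ENNReal.ofReal (Δ (rhoIncl p)) :=
    (hΔ.measurable.comp measurable_subtype_coe).ennreal_ofReal
  have hd := measurable_rhoExt hΔι
  set D : H → ℝ≥0∞ := fun h => ENNReal.ofReal (Δ (α.ofH h))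
  set d : UnitSpace H → G → ℝ≥0∞ := rhoExt fun p => ENNReal.ofReal (Δ (rhoIncl p))
  have hsplit : ∀ p : α.SemidirectProduct,
      ENNReal.ofReal (Δ p) = D (fst p) * d (srcUnit (fst p)) (snd p) := by
    intro p
    obtain ⟨e', he⟩ := α.exists_mul_ofH_rhoMk (fst p) (snd p) (moment_fst p)
    have hp : Δ p = Δ (α.ofH (fst p)) * Δ (rhoIncl (rhoMk (srcUnit (fst p)) (snd p)
        ((congrArg Subtype.val (α.moment_src (fst p))).trans (moment_fst p)))) := by
      rw [← hΔ.map_mul _ _ e', he]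
      rfl
    rw [hp, ENNReal.ofReal_mul (hΔ.pos _).le]
    exact congrArg (D (fst p) * ·)
      (rhoExt_rhoMk (fun p => ENNReal.ofReal (Δ (rhoIncl p))) (v := srcUnit (fst p)) _).symm
  intro F hF
  -- On `H ⋊ G`, `E` is the function `F · Δ`.
  let E : H → G → ℝ≥0∞ := fun k y => F k y * (D k * d (srcUnit k) y)
  have hE : Measurable fun p : H × G => E p.1 p.2 :=
    hF.mul ((hD.measurable.comp measurable_fst).mul
      (hd.comp ((measurable_srcUnit.comp measurable_fst).prodMk measurable_snd)))
  have hix : Measurable fun p : H × G => inv p.2 := measurable_arrowInv.comp measurable_snd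
  have hEi : Measurable fun p : H × G => E (α.actT (inv p.2) (inv p.1)) (inv p.2) :=
    hE.comp ((α.measurable_actT.comp
      (hix.prodMk (measurable_arrowInv.comp measurable_fst))).prodMk hix)
  have hFι : Measurable fun p : α.SemidirectProduct => F (fst p) (snd p) :=
    hF.comp α.measurableEmbedding_sd.measurable
  calc ∫⁻ v, ∫⁻ h, ∫⁻ x, F h x ∂lamG.meas (α.mom v) ∂lamH.meas v ∂μ
      = ∫⁻ p, F (fst p) (snd p) ∂inducedMeasure (α.sdHaar lamG lamH) (μ.map α.sdUnit) :=
        (α.lintegral_sdHaar lamG lamH μ hF).symm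
    _ = ∫⁻ p, E (α.actT (inv (snd p)) (inv (fst p))) (inv (snd p))
          ∂inducedMeasure (α.sdHaar lamG lamH) (μ.map α.sdUnit) := by
        rw [hΔ.lintegral_eq α.continuous_inv_sd.measurable hFι]
        refine lintegral_congr fun p => ?_
        rw [hsplit, fst_inv_eq]
        rfl
    _ = ∫⁻ v, ∫⁻ h, ∫⁻ x, E (α.actT (inv x) (inv h)) (inv x)
          ∂lamG.meas (α.mom v) ∂lamH.meas v ∂μ :=
        α.lintegral_sdHaar lamG lamH μ (F := fun h x => E (α.actT (inv x) (inv h)) (inv x)) hEi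
    _ = ∫⁻ v, ∫⁻ x, ∫⁻ h, E (α.actT (inv x) (inv h)) (inv x)
          ∂lamH.meas v ∂lamG.meas (α.mom v) ∂μ :=
        lintegral_congr fun v => lintegral_lintegral_swap hEi.aemeasurable
    _ = _ := by
        refine lintegral_congr fun v => lintegral_congr_ae ?_
        filter_upwards [lamG.ae_rngUnit (α.mom v)] with x hx
        have e : src (inv x) = (α.moment v.1).1 :=
          (src_inv x).trans (congrArg Subtype.val hx)
        have hEx : Measurable fun k => E (inv k) (inv x) :=
          hE.comp (measurable_arrowInv.prodMk measurable_const)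
        have hFx : Measurable fun k => F (inv k) (inv x) * D (inv k) :=
          (hF.comp (measurable_arrowInv.prodMk measurable_const)).mul
            (hD.measurable.comp measurable_arrowInv)
        rw [← lintegral_const_mul _ hFx]
        calc ∫⁻ h, E (α.actT (inv x) (inv h)) (inv x) ∂lamH.meas v
            = ∫⁻ h, E (inv (α.actT (inv x) h)) (inv x) ∂lamH.meas v := by
              refine lintegral_congr_ae ?_
              filter_upwards [α.ae_moment lamH v] with h hh
              have eh : src (inv x) = (α.moment h).1 := e.trans (congrArg Subtype.val hh).symm
              rw [α.actT_of eh, ← α.act_inv _ _ eh, α.actT_of]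
          _ = ∫⁻ k, E (inv k) (inv x) ∂lamH.meas (α.actUnitT (inv x) v) :=
              hinv.lintegral_actT e hEx
          _ = _ := by
              refine lintegral_congr_ae ?_
              filter_upwards [lamH.ae_rngUnit (α.actUnitT (inv x) v)] with k hk
              simp only [E, srcUnit_inv, hk]
              ring

theorem isModularFunction_ofH
    (hΔ : IsModularFunction (α.sdHaar lamG lamH) (μ.map α.sdUnit) Δ)
    (h : lamH.Intertwines (fun h => ENNReal.ofReal (Δ (α.ofH h))) μ μ) :
    IsModularFunction lamH.meas μ fun h => Δ (α.ofH h) where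
  measurable := hΔ.measurable.comp measurable_ofH
  pos h := hΔ.pos _
  map_mul h k e := by
    obtain ⟨e', he⟩ := α.mul_ofH e
    rw [← he, hΔ.map_mul]
  density := by
    have hm : Measurable fun h => Δ (α.ofH h) := hΔ.measurable.comp measurable_ofH
    refine inducedMeasure_eq_withDensity measurable_arrowInv hm fun f hf => ?_
    have hf' : Measurable fun x => f (inv x) * ENNReal.ofReal (Δ (α.ofH (inv x))) :=
      (hf.mul hm.ennreal_ofReal).comp measurable_arrowInv
    rw [inducedMeasure, Measure.lintegral_bind lamH.measurable_meas.aemeasurable hf.aemeasurable,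
      Measure.lintegral_bind lamH.measurable_meas.aemeasurable hf'.aemeasurable]
    exact h f hf

theorem isModularFunction_rhoIncl
    (hΔ : IsModularFunction (α.sdHaar lamG lamH) (μ.map α.sdUnit) Δ)
    (h : α.RhoIntertwines lamG μ (rhoExt fun p => ENNReal.ofReal (Δ (rhoIncl p))) μ) :
    IsModularFunction (α.rhoHaar lamG) (μ.map α.rhoUnit) fun p => Δ (rhoIncl p) where
  measurable := hΔ.measurable.comp measurable_subtype_coe
  pos p := hΔ.pos _
  map_mul p q e := hΔ.map_mul _ _ (congrArg rhoIncl e)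
  density := by
    have hm : Measurable fun p : α.RhoGroupoid => Δ (rhoIncl p) :=
      hΔ.measurable.comp measurable_subtype_coe
    refine inducedMeasure_eq_withDensity α.continuous_inv_rho.measurable hm fun f hf => ?_
    have hfe := measurable_rhoExt hf
    have hde := measurable_rhoExt hm.ennreal_ofReal
    have hj : Measurable fun q : UnitSpace H × G => (α.actUnitT (inv q.2) q.1, inv q.2) :=
      (α.measurable_actUnitT.comp ((measurable_arrowInv.comp measurable_snd).prodMk
        measurable_fst)).prodMk (measurable_arrowInv.comp measurable_snd)
    refine (lintegral_congr fun p => (rhoExt_apply f p).symm).trans ?_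
    refine (α.lintegral_rhoHaar lamG μ hfe).trans ((h _ hfe).trans ?_)
    refine (α.lintegral_rhoHaar lamG μ ((hde.mul hfe).comp hj)).symm.trans ?_
    refine lintegral_congr fun p => ?_
    rw [← rhoExt_apply f (inv p),
      ← rhoExt_apply (fun p => ENNReal.ofReal (Δ (rhoIncl p))) (inv p), rngUnit_fst_inv, mul_comm]
    rfl

end IsoAction
theorem mainTheorem6 {G H : Type*}
    [TopologicalSpace G] [LocallyCompactSpace G] [T2Space G] [SecondCountableTopology G]
    [MeasurableSpace G] [BorelSpace G] [ArrowGroupoid G] [OpenTopGroupoid G]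
    [TopologicalSpace H] [LocallyCompactSpace H] [T2Space H] [SecondCountableTopology H]
    [MeasurableSpace H] [BorelSpace H] [ArrowGroupoid H] [OpenTopGroupoid H]
    (lamG : HaarSystem G) (lamH : HaarSystem H)
    (α : IsoAction G H) (hinv : α.Invariant lamH)
    (μ : Measure (UnitSpace H)) [SigmaFinite μ]
    (hμ : QuasiInvariant (α.sdHaar lamG lamH) (μ.map α.sdUnit))
    (Δ : α.SemidirectProduct → ℝ)
    (hΔ : IsModularFunction (α.sdHaar lamG lamH) (μ.map α.sdUnit) Δ) :
    ∃ (ΔH : H → ℝ) (δ : α.RhoGroupoid → ℝ),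
      (∀ h, ΔH h = Δ (IsoAction.sdMk h (α.moment h).1 (α.moment h).2.symm)) ∧
      (∀ (v : UnitSpace H) (x : G) (e : (α.moment v.1).1 = rng x),
        δ (IsoAction.rhoMk v x e) = Δ (IsoAction.sdMk v.1 x e)) ∧
      QuasiInvariant lamH.meas μ ∧
      IsModularFunction lamH.meas μ ΔH ∧
      QuasiInvariant (α.rhoHaar lamG) (μ.map α.rhoUnit) ∧
      IsModularFunction (α.rhoHaar lamG) (μ.map α.rhoUnit) δ ∧
      ∀ (h : H) (x : G) (e : (α.moment h).1 = rng x),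
        Δ (IsoAction.sdMk h x e) =
          ΔH h * δ (IsoAction.rhoMk (srcUnit h) x
            ((congrArg Subtype.val (α.moment_src h)).trans e)) := by
  obtain ⟨hH, hρ⟩ := (IsoAction.splitDensity hinv hΔ).modular (IsoAction.isBorelHom_ofH hΔ)
  have hmH := IsoAction.isModularFunction_ofH hΔ hH
  have hmρ := IsoAction.isModularFunction_rhoIncl hΔ hρ
  refine ⟨fun h => Δ (α.ofH h), fun p => Δ (IsoAction.rhoIncl p), fun _ => rfl, fun _ _ _ => rfl,
    hmH.quasiInvariant, hmH, hmρ.quasiInvariant, hmρ, fun h x e => ?_⟩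
  obtain ⟨e', he⟩ := α.exists_mul_ofH_rhoMk h x e
  rw [← he, hΔ.map_mul]
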